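/- Let $K$ be an ordered field and $n\ge 1$. Let $\mathbf P_+=(K^n\setminus\{0\})/K_+$, where $K_+=\{\lambda\in K:\lambda>0\}$ acts by homotheties, and let $G=P_+GL_+(n,K)=\{g\in GL(n,K):\det g>0\}/\{\lambda I:\lambda\in K_+\}$, acting on $\mathbf P_+$. Let $X_+$ be the simplicial complex with vertex set $\mathbf P_+$ in which distinct points $[v_0],\dots,[v_k]$ span a simplex if and only if every subsequence of $(v_0,\dots,v_k)$ of length $\le n$ is linearly independent. Let $C_*X_+$ be its alternating simplicial chain complex over $\mathbf Z$, with boundaries $B_*X_+$, let $U_+=(C_nX_+/B_nX_+)_G$ (coinvariants), and let $T_+\colon C_nX_+\to U_+$ be the quotient map, an equivariant $n$-cocycle. Let $\psi\colon P_*\to C_*X_+$ be a $G$-chain map, respecting augmentations, from the bar resolution $P_*$ of the trivial $G$-module $\mathbf Z$, and let $eu_+=[T_+\circ\psi_n]\in H^n(G,U_+)$. For $0\le k\le\lfloor n/2\rfloor$ let $k^+\in U_+$ be the image of the simplex $([e_1],\dots,[e_n],[e_1+\dots+e_k-e_{k+1}-\dots-e_n])$. Such maps $\psi$ exist, and $U_+$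 is a free abelian group with basis $\{k^+:0\le k\le\lfloor n/2\rfloor\}$. Let $T_k\colon C_nX_+\to\mathbf Z$ and $eu_k\in H^n(G,\mathbf Z)$ be the images of $T_+$ and $eu_+$ under the coordinate projection $U_+\to\mathbf Z$ corresponding to $k^+$. Then, for every $\psi$ as above, $$\sum_{k=0}^{\lfloor n/2\rfloor}(n-2k+1)\,eu_k=0\quad\text{in } H^n(P_+GL_+(n,K),\mathbf Z).$$ The relation already holds for cochains: there is a $G$-equivariant cochain $c\colon C_{n-1}X_+\to\mathbf Z$ with $c([v_1],\dots,[v_n])=(-1)^n\operatorname{sgn}\det(v_1,\dots,v_n)$ for each ordered $(n-1)$-simplex $([v_1],\dots,[v_n])$ of $X_+$, and $$\delta c=c\circ\partial=\sum_{k=0}^{\lfloor n/2\rfloor}(n-2k+1)\,T_k\quad\text{in }\operatorname{Hom}_G(C_nX_+,\mathbf Z).$$ -/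

import Mathlib

open CategoryTheory

universe u

noncomputable section

namespace Taut

/-! ### Group-theoretic tautological classes of chain complexes

`R` is the ring of coefficients (a copy of `ℤ` in the application), `G` a group, and a `G`-chain
complex is a chain complex of representations of `G`. -/

section Algebra

variable {R G : Type u} [CommRing R] [Group G]

/-- The boundaries `B_d ⊆ C_d`. -/
def boundaries (C : ChainComplex (Rep.{u} R G) ℕ) (d : ℕ) : Submodule R (C.X d) :=
  LinearMap.range (C.d (d + 1) d).hom.toLinearMap

lemma boundaries_le_comap (C : ChainComplex (Rep.{u} R G) ℕ) (d : ℕ) (g : G) :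
    boundaries C d ≤ (boundaries C d).comap ((C.X d).ρ g) := by
  rintro _ ⟨x, rfl⟩
  exact ⟨(C.X (d + 1)).ρ g x, Rep.hom_comm_apply (C.d (d + 1) d) g x⟩

/-- The `G`-module `C_d / B_d`. -/
abbrev chainsModBoundaries (C : ChainComplex (Rep.{u} R G) ℕ) (d : ℕ) : Rep.{u} R G :=
  (C.X d).quotient (boundaries C d) (boundaries_le_comap C d)

/-- The coefficient group `U_d(C) = (C_d / B_d)_G`, the coinvariants of `C_d / B_d`. -/
abbrev coeffGroup (C : ChainComplex (Rep.{u} R G) ℕ) (d : ℕ) : Type u :=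
  (chainsModBoundaries C d).ρ.Coinvariants

/-- The tautological cocycle `C_d → C_d / B_d → U_d(C)`, a `G`-map to the trivial `G`-module
`U_d(C)`. -/
def tautCocycle (C : ChainComplex (Rep.{u} R G) ℕ) (d : ℕ) :
    C.X d ⟶ Rep.trivial R G (coeffGroup C d) :=
  (C.X d).mkQ (boundaries C d) (boundaries_le_comap C d) ≫
    Rep.ofHom ⟨Representation.Coinvariants.mk (chainsModBoundaries C d).ρ, fun g => by
      ext x
      exact Representation.Coinvariants.mk_self_apply (chainsModBoundaries C d).ρ g _⟩

lemma d_comp_tautCocycle (C : ChainComplex (Rep.{u} R G) ℕ) (d : ℕ) :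
    C.d (d + 1) d ≫ tautCocycle C d = 0 := by
  have h : C.d (d + 1) d ≫ (C.X d).mkQ (boundaries C d) (boundaries_le_comap C d) = 0 := by
    ext x
    exact (Submodule.Quotient.mk_eq_zero _).2 ⟨x, rfl⟩
  rw [tautCocycle, ← Category.assoc, h, Limits.zero_comp]

/-- The class in `Hᵈ(Hom_G(C, A))` of a `G`-map `T : C_d ⟶ A` that vanishes on boundaries. -/
def homClass (C : ChainComplex (Rep.{u} R G) ℕ) (A : Rep.{u} R G) (d : ℕ)
    (T : C.X d ⟶ A) (hT : C.d (d + 1) d ≫ T = 0) :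
    (C.linearYonedaObj R A).homology d :=
  (C.linearYonedaObj R A).homologyπ d
    ((C.linearYonedaObj R A).cyclesMk T (d + 1) (by simp) hT)

/-- A `G`-chain map `ψ : P ⟶ C` induces the cochain map `Hom_G(C, A) ⟶ Hom_G(P, A)`. -/
def homPullback {P C : ChainComplex (Rep.{u} R G) ℕ} (ψ : P ⟶ C) (A : Rep.{u} R G) :
    C.linearYonedaObj R A ⟶ P.linearYonedaObj R A where
  f i := ModuleCat.ofHom (Linear.leftComp R A (ψ.f i))
  comm' i j _ := by
    rw [ChainComplex.linearYonedaObj_d, ChainComplex.linearYonedaObj_d]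
    refine ModuleCat.hom_ext (LinearMap.ext fun (T : C.X i ⟶ A) => ?_)
    change P.d j i ≫ ψ.f i ≫ T = ψ.f j ≫ C.d j i ≫ T
    rw [← Category.assoc, ← Category.assoc, ψ.comm]

/-- A `G`-chain map `ψ` from the bar resolution to `C` induces
`ψ^* : Hᵈ(Hom_G(C, A)) ⟶ Hᵈ(G, A)`. -/
def pullbackClass {C : ChainComplex (Rep.{u} R G) ℕ} (ψ : Rep.barComplex R G ⟶ C)
    (A : Rep.{u} R G) (d : ℕ) :
    (C.linearYonedaObj R A).homology d ⟶ groupCohomology A d :=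
  HomologicalComplex.homologyMap
    (homPullback ψ A ≫ (groupCohomology.inhomogeneousCochainsIso A).inv) d

/-- The tautological class `ψ^*[T] ∈ Hᵈ(G, U_d(C))`, where `T` is the tautological cocycle of `C`
and `ψ` is a chain map from the bar resolution to `C`. -/
def tautClass {C : ChainComplex (Rep.{u} R G) ℕ} (ψ : Rep.barComplex R G ⟶ C) (d : ℕ) :
    groupCohomology (Rep.trivial R G (coeffGroup C d)) d :=
  pullbackClass ψ _ d (homClass C _ d (tautCocycle C d) (d_comp_tautCocycle C d))

/-- A linear map as a morphism of trivial `G`-modules. -/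
def trivialMap {M N : Type u} [AddCommGroup M] [Module R M] [AddCommGroup N] [Module R N]
    (p : M →ₗ[R] N) : Rep.trivial R G M ⟶ Rep.trivial R G N :=
  Rep.ofHom ⟨p, fun _ => rfl⟩

/-- The map `Hᵈ(G, M) → Hᵈ(G, N)` induced by a linear map `M → N`. -/
def coeffMap {M N : Type u} [AddCommGroup M] [Module R M] [AddCommGroup N] [Module R N]
    (p : M →ₗ[R] N) (d : ℕ) :
    groupCohomology (Rep.trivial R G M) d ⟶ groupCohomology (Rep.trivial R G N) d :=
  (groupCohomology.functor R G d).map (trivialMap p)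

end Algebra

/-! ### Simplicial chains of a simplicial complex with a group action -/

section Simplicial

variable {V : Type u}

/-- Non-degenerate ordered `k`-simplices: tuples of `k + 1` distinct vertices that span a
simplex. -/
def OrdSimplex (X : AbstractSimplicialComplex V) (k : ℕ) : Type u :=
  {p : Fin (k + 1) ↪ V // Finset.univ.map p ∈ X.faces}

namespace OrdSimplex

variable {X : AbstractSimplicialComplex V} {k : ℕ}

@[ext]
lemma ext {σ τ : OrdSimplex X k} (h : ∀ i, σ.1 i = τ.1 i) : σ = τ :=
  Subtype.ext (DFunLike.ext _ _ h)

/-- Reordering the vertices of an ordered simplex. -/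
def perm (σ : OrdSimplex X k) (t : Equiv.Perm (Fin (k + 1))) : OrdSimplex X k :=
  ⟨t.toEmbedding.trans σ.1, by
    rw [← Finset.map_map, Finset.map_univ_equiv]
    exact σ.2⟩

@[simp]
lemma perm_apply (σ : OrdSimplex X k) (t : Equiv.Perm (Fin (k + 1))) (i : Fin (k + 1)) :
    (σ.perm t).1 i = σ.1 (t i) := rfl

/-- The `i`-th face: omit the `i`-th vertex. -/
def face (σ : OrdSimplex X (k + 1)) (i : Fin (k + 2)) : OrdSimplex X k :=
  ⟨i.succAboveEmb.trans σ.1, by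
    refine (X.isRelLowerSet_faces σ.2).2 ?_ (by simp)
    rw [← Finset.map_map]
    exact Finset.map_subset_map.2 (Finset.subset_univ _)⟩

@[simp]
lemma face_apply (σ : OrdSimplex X (k + 1)) (i : Fin (k + 2)) (j : Fin (k + 1)) :
    (σ.face i).1 j = σ.1 (i.succAbove j) := rfl

end OrdSimplex

variable (R : Type u) [CommRing R]

/-- The alternation relations `tσ = sgn(t) σ`. -/
def alternation (X : AbstractSimplicialComplex V) (k : ℕ) : Submodule R (OrdSimplex X k →₀ R) :=
  Submodule.span R {x | ∃ (σ : OrdSimplex X k) (t : Equiv.Perm (Fin (k + 1))),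
    x = Finsupp.single (σ.perm t) 1 - (Equiv.Perm.sign t : ℤ) • Finsupp.single σ 1}

/-- The alternating simplicial chains `C_k X`: the free module on the ordered simplices modulo the
alternation relations. -/
abbrev Chain (X : AbstractSimplicialComplex V) (k : ℕ) : Type u :=
  (OrdSimplex X k →₀ R) ⧸ alternation R X k

variable {R} {X : AbstractSimplicialComplex V} {k : ℕ}

variable (R) in
/-- The chain `[σ]` given by an ordered simplex `σ`. -/
def Chain.of (σ : OrdSimplex X k) : Chain R X k :=
  (alternation R X k).mkQ (Finsupp.single σ 1)

lemma Chain.of_perm (σ : OrdSimplex X k) (t : Equiv.Perm (Fin (k + 1))) :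
    Chain.of R (σ.perm t) = (Equiv.Perm.sign t : ℤ) • Chain.of R σ := by
  rw [← sub_eq_zero, Chain.of, Chain.of, ← map_zsmul, ← map_sub]
  exact (Submodule.Quotient.mk_eq_zero _).2 (Submodule.subset_span ⟨σ, t, rfl⟩)

/-- A function on ordered simplices that satisfies the alternation relations extends to chains. -/
def Chain.lift {M : Type*} [AddCommGroup M] [Module R M] (f : OrdSimplex X k → M)
    (hf : ∀ σ t, f (σ.perm t) = (Equiv.Perm.sign t : ℤ) • f σ) : Chain R X k →ₗ[R] M :=
  (alternation R X k).liftQ (Finsupp.linearCombination R f) <| by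
    rw [alternation, Submodule.span_le]
    rintro _ ⟨σ, t, rfl⟩
    rw [SetLike.mem_coe, LinearMap.mem_ker, map_sub, map_zsmul]
    simp [hf]

@[simp]
lemma Chain.lift_of {M : Type*} [AddCommGroup M] [Module R M] (f : OrdSimplex X k → M)
    (hf : ∀ σ t, f (σ.perm t) = (Equiv.Perm.sign t : ℤ) • f σ) (σ : OrdSimplex X k) :
    Chain.lift (R := R) f hf (Chain.of R σ) = f σ := by
  change Finsupp.linearCombination R f (Finsupp.single σ 1) = f σ
  simp

lemma Chain.hom_ext {M : Type*} [AddCommGroup M] [Module R M] {f g : Chain R X k →ₗ[R] M}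
    (h : ∀ σ, f (Chain.of R σ) = g (Chain.of R σ)) : f = g := by
  apply Submodule.linearMap_qext
  ext σ
  exact h σ

/-- A permutation `t` of the vertices of a simplex induces a permutation between the vertices
of the `j`-th face and those of the `t j`-th face; its sign is `sgn(t) (-1)^(j + t j)`. -/
lemma exists_facePerm (t : Equiv.Perm (Fin (k + 2))) (j : Fin (k + 2)) :
    ∃ s : Equiv.Perm (Fin (k + 1)), (∀ i, t (j.succAbove i) = (t j).succAbove (s i)) ∧
      (-1 : ℤ) ^ (j : ℕ) * Equiv.Perm.sign s = Equiv.Perm.sign t * (-1) ^ (t j : ℕ) := by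
  set P : Equiv.Perm (Fin (k + 2)) := (t j).cycleRange * t * j.cycleRange⁻¹ with hP
  have hP0 : P 0 = 0 := by
    have : j.cycleRange⁻¹ 0 = j := by
      rw [Equiv.Perm.inv_eq_iff_eq]; simp
    rw [hP, Equiv.Perm.mul_apply, Equiv.Perm.mul_apply, this, Fin.cycleRange_self]
  obtain ⟨⟨p, s⟩, hs⟩ := (Equiv.Perm.decomposeFin (n := k + 1)).symm.surjective P
  have hp : p = 0 := by
    have := Equiv.Perm.decomposeFin_symm_apply_zero p s
    rw [hs, hP0] at this
    exact this.symm
  subst hp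
  have hsucc : ∀ i, P i.succ = (s i).succ := fun i => by
    rw [← hs]; simp
  have hsign : Equiv.Perm.sign P = Equiv.Perm.sign s := by
    rw [← hs]; simp
  refine ⟨s, fun i => ?_, ?_⟩
  · have h1 : j.cycleRange⁻¹ i.succ = j.succAbove i := Fin.cycleRange_symm_succ j i
    have h2 : (t j).cycleRange⁻¹ (s i).succ = (t j).succAbove (s i) :=
      Fin.cycleRange_symm_succ (t j) (s i)
    rw [← h2, ← hsucc i, ← h1]
    simp [hP]
  · rw [← hsign, hP]
    simp only [Equiv.Perm.sign_mul, Equiv.Perm.sign_inv, Fin.sign_cycleRange]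
    push_cast
    have : ((-1 : ℤ) ^ (j : ℕ)) * (-1) ^ (j : ℕ) = 1 := by
      rw [← mul_pow]; simp
    linear_combination (((Equiv.Perm.sign t : ℤˣ) : ℤ) * (-1) ^ (t j : ℕ)) * this

variable (R X k) in
/-- The boundary operator `∂[v₀, …, v_{k+1}] = ∑ᵢ (-1)ⁱ [v₀, …, v̂ᵢ, …, v_{k+1}]`. -/
def boundary : Chain R X (k + 1) →ₗ[R] Chain R X k :=
  Chain.lift (fun σ => ∑ i : Fin (k + 2), (-1 : ℤ) ^ (i : ℕ) • Chain.of R (σ.face i)) <| by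
    intro σ t
    rw [Finset.smul_sum, ← Equiv.sum_comp t fun i =>
      (Equiv.Perm.sign t : ℤ) • (-1 : ℤ) ^ (i : ℕ) • Chain.of R (σ.face i)]
    refine Finset.sum_congr rfl fun j _ => ?_
    obtain ⟨s, hs, hsign⟩ := exists_facePerm t j
    have : (σ.perm t).face j = (σ.face (t j)).perm s := by
      ext i
      simp [hs]
    rw [this, Chain.of_perm, smul_smul, smul_smul, hsign]

@[simp]
lemma boundary_of (σ : OrdSimplex X (k + 1)) :
    boundary R X k (Chain.of R σ) =
      ∑ i : Fin (k + 2), (-1 : ℤ) ^ (i : ℕ) • Chain.of R (σ.face i) :=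
  Chain.lift_of _ _ σ

lemma boundary_boundary : boundary R X k ∘ₗ boundary R X (k + 1) = 0 := by
  refine Chain.hom_ext fun σ => ?_
  simp only [LinearMap.comp_apply, boundary_of, map_sum, map_zsmul, LinearMap.zero_apply,
    Finset.smul_sum, smul_smul]
  rw [← Finset.sum_product']
  refine Finset.sum_involution
    (fun p _ => (p.1.succAbove p.2, p.2.predAbove p.1)) ?_ ?_ ?_ ?_
  · rintro ⟨j, i⟩ -
    have hface : (σ.face j).face i = (σ.face (j.succAbove i)).face (i.predAbove j) := by
      ext m
      simp only [OrdSimplex.face_apply]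
      rw [Fin.succAbove_succAbove_succAbove_predAbove]
    simp only
    rw [hface, ← add_smul]
    convert zero_smul ℤ _
    rcases lt_or_ge i.castSucc j with h | h
    · rw [Fin.succAbove_of_castSucc_lt _ _ h, Fin.predAbove_of_castSucc_lt _ _ h]
      obtain ⟨m, hm⟩ : ∃ m, (j : ℕ) = m + 1 := ⟨j - 1, by
        have : (i : ℕ) < j := h
        omega⟩
      simp [hm, pow_succ]
      ring
    · rw [Fin.succAbove_of_le_castSucc _ _ h, Fin.predAbove_of_le_castSucc _ _ h]
      simp [pow_succ]
      ring
  · rintro ⟨j, i⟩ - - h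
    exact Fin.succAbove_ne j i (congrArg Prod.fst h)
  · intros; simp
  · rintro ⟨j, i⟩ -
    ext1 <;> simp [Fin.succAbove_succAbove_predAbove, Fin.predAbove_predAbove_succAbove]

variable (R X) in
/-- The augmentation `C_0 X → R`, sending every vertex to `1`. -/
def augmentation : Chain R X 0 →ₗ[R] R :=
  Chain.lift (fun _ => 1) fun _ t => by
    rw [Subsingleton.elim (α := Equiv.Perm (Fin 1)) t 1]; simp

lemma augmentation_boundary : augmentation R X ∘ₗ boundary R X 0 = 0 := by
  refine Chain.hom_ext fun σ => ?_
  simp [augmentation, Fin.sum_univ_succ]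

variable (G : Type u) [Group G] [MulAction G V]

/-- The group `G`, acting on the vertices, acts on `X` by simplicial automorphisms. -/
class SimplicialAction (X : AbstractSimplicialComplex V) : Prop where
  map_mem : ∀ (g : G), ∀ s ∈ X.faces, s.map (MulAction.toPerm g).toEmbedding ∈ X.faces

variable {G} [SimplicialAction G X]

/-- The action of `G` on ordered simplices. -/
def OrdSimplex.act (g : G) (σ : OrdSimplex X k) : OrdSimplex X k :=
  ⟨σ.1.trans (MulAction.toPerm g).toEmbedding, by
    rw [← Finset.map_map]
    exact SimplicialAction.map_mem g _ σ.2⟩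

@[simp]
lemma OrdSimplex.act_apply (g : G) (σ : OrdSimplex X k) (i : Fin (k + 1)) :
    (σ.act g).1 i = g • σ.1 i := rfl

@[simp]
lemma OrdSimplex.act_perm (g : G) (σ : OrdSimplex X k) (t : Equiv.Perm (Fin (k + 1))) :
    (σ.perm t).act g = (σ.act g).perm t := rfl

variable (R) in
/-- The action of `g` on chains, `[v₀, …, v_k] ↦ [g v₀, …, g v_k]`. -/
def Chain.act (g : G) : Chain R X k →ₗ[R] Chain R X k :=
  Chain.lift (fun σ => Chain.of R (σ.act g)) fun σ t => by
    rw [OrdSimplex.act_perm, Chain.of_perm]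

@[simp]
lemma Chain.act_of (g : G) (σ : OrdSimplex X k) :
    Chain.act R g (Chain.of R σ) = Chain.of R (σ.act g) :=
  Chain.lift_of _ _ σ

variable (R X k G) in
/-- The representation of `G` on simplicial chains. -/
def chainRep : Representation R G (Chain R X k) where
  toFun g := Chain.act R g
  map_one' := by
    refine Chain.hom_ext fun σ => ?_
    rw [Chain.act_of, Module.End.one_apply]
    refine congrArg (Chain.of R) ?_
    ext i
    simp
  map_mul' g h := by
    refine Chain.hom_ext fun σ => ?_
    rw [Module.End.mul_apply, Chain.act_of, Chain.act_of, Chain.act_of]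
    refine congrArg (Chain.of R) ?_
    ext i
    simp [mul_smul]

@[simp]
lemma chainRep_of (g : G) (σ : OrdSimplex X k) :
    chainRep R X k G g (Chain.of R σ) = Chain.of R (σ.act g) :=
  Chain.act_of g σ

variable (R X k G) in
/-- The boundary operator as a map of `G`-modules. -/
def boundaryHom : Rep.of (chainRep R X (k + 1) G) ⟶ Rep.of (chainRep R X k G) :=
  Rep.ofHom ⟨boundary R X k, fun g => by
    refine Chain.hom_ext fun σ => ?_
    simp only [LinearMap.comp_apply, chainRep_of, boundary_of, map_sum, map_zsmul]
    rfl⟩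

variable (R X G) in
/-- The simplicial chain complex `C_* X` as a complex of `G`-modules. -/
def chainComplex : ChainComplex (Rep.{u} R G) ℕ :=
  ChainComplex.of (fun k => Rep.of (chainRep R X k G)) (fun k => boundaryHom R X k G)
    (fun _ => Rep.hom_ext (Representation.IntertwiningMap.ext boundary_boundary))

lemma chainComplex_d : (chainComplex R X G).d (k + 1) k = boundaryHom R X k G := by
  simp [chainComplex]

variable (R G) in
/-- The chain `[σ]`, as an element of the complex `C_* X`. -/
def simplexChain (σ : OrdSimplex X k) : (chainComplex R X G).X k :=
  Chain.of R σ

variable (R X G) in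
/-- The augmentation of `C_* X`, as a chain map to the complex `R` concentrated in degree `0`. -/
def augmentationMap :
    chainComplex R X G ⟶ (ChainComplex.single₀ (Rep.{u} R G)).obj (Rep.trivial R G R) :=
  ((chainComplex R X G).toSingle₀Equiv (Rep.trivial R G R)).symm
    ⟨Rep.ofHom ⟨augmentation R X, fun g => by
        refine Chain.hom_ext fun σ => ?_
        change augmentation R X (chainRep R X 0 G g (Chain.of R σ)) =
          augmentation R X (Chain.of R σ)
        simp [augmentation]⟩, by
      rw [chainComplex_d]
      exact Rep.hom_ext (Representation.IntertwiningMap.ext augmentation_boundary)⟩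

end Simplicial

/-! ### The group `P₊GL₊(n, K)` and the complex `X₊` of generic tuples in `P₊ⁿ⁻¹(K)` -/

section Generic

variable (K : Type u) [Field K] [LinearOrder K] [IsStrictOrderedRing K] (n : ℕ)

/-- The positive projective space `P₊ⁿ⁻¹(K) = (Kⁿ ∖ 0) / K₊`. -/
abbrev PosProj : Type u := Module.Ray K (Fin n → K)

/-- The subgroup `{λ I ∣ λ > 0}` of `GL₊(n, K)`. -/
def posScalars : Subgroup (Matrix.GLPos (Fin n) K) where
  carrier := {g | ∃ c : K, 0 < c ∧
    ((g : Matrix.GeneralLinearGroup (Fin n) K) : Matrix (Fin n) (Fin n) K) = c • 1}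
  one_mem' := ⟨1, one_pos, by simp⟩
  mul_mem' := by
    rintro g h ⟨c, hc, hg⟩ ⟨d, hd, hh⟩
    exact ⟨c * d, mul_pos hc hd, by simp [hg, hh, smul_smul, mul_comm]⟩
  inv_mem' := by
    rintro g ⟨c, hc, hg⟩
    refine ⟨c⁻¹, inv_pos.2 hc, ?_⟩
    have h : ((g : Matrix.GeneralLinearGroup (Fin n) K) : Matrix (Fin n) (Fin n) K) *
        (((g⁻¹ : Matrix.GLPos (Fin n) K) : Matrix.GeneralLinearGroup (Fin n) K) :
          Matrix (Fin n) (Fin n) K) = 1 := by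
      rw [← Units.val_mul, ← Subgroup.coe_mul, mul_inv_cancel]; rfl
    rw [hg, smul_mul_assoc, one_mul] at h
    rw [← h, smul_smul, inv_mul_cancel₀ hc.ne', one_smul]

instance : (posScalars K n).Normal where
  conj_mem := by
    rintro g ⟨c, hc, hg⟩ h
    refine ⟨c, hc, ?_⟩
    have h1 : ((h : Matrix.GeneralLinearGroup (Fin n) K) : Matrix (Fin n) (Fin n) K) *
        (((h⁻¹ : Matrix.GLPos (Fin n) K) : Matrix.GeneralLinearGroup (Fin n) K) :
          Matrix (Fin n) (Fin n) K) = 1 := by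
      rw [← Units.val_mul, ← Subgroup.coe_mul, mul_inv_cancel]; rfl
    rw [Subgroup.coe_mul, Subgroup.coe_mul, Units.val_mul, Units.val_mul, hg, mul_smul_comm,
      mul_one, smul_mul_assoc, h1]

/-- The group `P₊GL₊(n, K) = GL₊(n, K) / {λ I ∣ λ > 0}`. -/
abbrev PGLPos : Type u := Matrix.GLPos (Fin n) K ⧸ posScalars K n

/-- The linear automorphism of `Kⁿ` given by a matrix in `GL₊(n, K)`. -/
def linEquiv : Matrix.GLPos (Fin n) K →* ((Fin n → K) ≃ₗ[K] (Fin n → K)) :=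
  ((LinearMap.GeneralLinearGroup.generalLinearEquiv K (Fin n → K)).toMonoidHom.comp
    (Matrix.GeneralLinearGroup.toLin (n := Fin n) (R := K)).toMonoidHom).comp
    (Matrix.GLPos (Fin n) K).subtype

lemma linEquiv_apply (g : Matrix.GLPos (Fin n) K) (v : Fin n → K) :
    linEquiv K n g v =
      ((g : Matrix.GeneralLinearGroup (Fin n) K) : Matrix (Fin n) (Fin n) K).mulVec v := rfl

/-- The action of `GL₊(n, K)` on `P₊ⁿ⁻¹(K)`, `g [v] = [g v]`. -/
def rayPerm : Matrix.GLPos (Fin n) K →* Equiv.Perm (PosProj K n) where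
  toFun g := Module.Ray.map (linEquiv K n g)
  map_one' := by
    rw [map_one]
    exact Module.Ray.map_refl
  map_mul' g h := by
    ext p
    induction p using Module.Ray.ind with
    | h v hv => simp [Module.Ray.map_apply]

/-- The induced action of `P₊GL₊(n, K)` on `P₊ⁿ⁻¹(K)`. -/
def projRayPerm : PGLPos K n →* Equiv.Perm (PosProj K n) :=
  QuotientGroup.lift (posScalars K n) (rayPerm K n) <| by
    rintro g ⟨c, hc, hg⟩
    ext p
    induction p using Module.Ray.ind with
    | h v hv =>
      change Module.Ray.map (linEquiv K n g) (rayOfNeZero K v hv) = rayOfNeZero K v hv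
      rw [Module.Ray.map_apply, ray_eq_iff, linEquiv_apply, hg, Matrix.smul_mulVec,
        Matrix.one_mulVec]
      exact SameRay.sameRay_pos_smul_left v hc

instance : MulAction (PGLPos K n) (PosProj K n) where
  smul g p := projRayPerm K n g p
  one_smul p := by
    change projRayPerm K n 1 p = p
    rw [map_one]; rfl
  mul_smul g h p := by
    change projRayPerm K n (g * h) p = projRayPerm K n g (projRayPerm K n h p)
    rw [map_mul]; rfl

lemma mk_smul_ray (g : Matrix.GLPos (Fin n) K) (p : PosProj K n) :
    (QuotientGroup.mk g : PGLPos K n) • p = Module.Ray.map (linEquiv K n g) p := rfl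

variable {K n}

/-- Linear independence of vectors representing a set of points of `P₊ⁿ⁻¹(K)` does not depend on
the chosen representatives. -/
lemma linearIndepOn_someVector_iff {ι : Type*} (p : ι → PosProj K n) (v : ι → Fin n → K)
    (hv : ∀ i, v i ≠ 0) (h : ∀ i, p i = rayOfNeZero K (v i) (hv i)) (s : Set ι) :
    LinearIndepOn K (fun i => (p i).someVector) s ↔ LinearIndepOn K v s := by
  have key : ∀ i, ∃ c : Kˣ, c • v i = (p i).someVector := fun i => by
    have h1 : SameRay K (p i).someVector (v i) := by
      rw [← ray_eq_iff (p i).someVector_ne_zero (hv i), Module.Ray.someVector_ray, h i]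
    obtain ⟨a, b, ha, hb, hab⟩ := h1.exists_pos (p i).someVector_ne_zero (hv i)
    refine ⟨Units.mk0 (a⁻¹ * b) (mul_pos (inv_pos.2 ha) hb).ne', ?_⟩
    rw [Units.smul_def, Units.val_mk0, mul_smul, ← hab, smul_smul, inv_mul_cancel₀ ha.ne',
      one_smul]
  choose c hc using key
  have : (fun i : s => (p i).someVector) = (fun i : s => c i) • (fun i : s => v i) := by
    ext1 i
    exact (hc i).symm
  rw [LinearIndepOn, LinearIndepOn, this]
  exact LinearIndependent.units_smul_iff _ _

/-- A finite set of points of `P₊ⁿ⁻¹(K)` is generic if all its subsets of at most `n` points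
are represented by linearly independent vectors. -/
def IsGeneric (s : Finset (PosProj K n)) : Prop :=
  ∀ t ⊆ s, t.card ≤ n → LinearIndepOn K (fun p : PosProj K n => p.someVector) (t : Set _)

variable (K n) in
/-- The simplicial complex `X₊`: the vertices are the points of `P₊ⁿ⁻¹(K)`, and the simplices are
spanned on generic tuples. -/
def genericComplex : AbstractSimplicialComplex (PosProj K n) where
  faces := {s | s.Nonempty ∧ IsGeneric s}
  isRelLowerSet_faces := fun _ hs =>
    ⟨hs.1, fun _ hts ht => ⟨ht, fun r hr => hs.2 r (hr.trans hts)⟩⟩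
  singleton_mem := fun p => ⟨Finset.singleton_nonempty p, fun t ht _ => by
    have h : LinearIndepOn K (fun p : PosProj K n => p.someVector) ({p} : Set (PosProj K n)) :=
      (linearIndepOn_singleton_iff K).2 p.someVector_ne_zero
    exact h.mono (by exact_mod_cast ht)⟩

instance : SimplicialAction (PGLPos K n) (genericComplex K n) where
  map_mem := by
    intro g s hs
    induction g using QuotientGroup.induction_on with
    | H g =>
      refine ⟨hs.1.map, fun t ht htn => ?_⟩
      obtain ⟨r, hr, rfl⟩ := Finset.subset_map_iff.1 ht
      rw [Finset.card_map] at htn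
      have h := hs.2 r hr htn
      rw [Finset.coe_map]
      refine LinearIndepOn.image_of_comp (f := fun p => (QuotientGroup.mk g : PGLPos K n) • p)
        (g := fun p : PosProj K n => p.someVector) ?_
      have hL : LinearIndepOn K
          (fun p : PosProj K n => linEquiv K n g p.someVector) (r : Set _) :=
        h.map_injOn (linEquiv K n g : (Fin n → K) →ₗ[K] (Fin n → K))
          (linEquiv K n g).injective.injOn
      refine (linearIndepOn_someVector_iff
        (fun p => (QuotientGroup.mk g : PGLPos K n) • p) _
        (fun p => (linEquiv K n g).map_ne_zero_iff.2 p.someVector_ne_zero)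
        (fun p => ?_) _).2 hL
      rw [mk_smul_ray, ← Module.Ray.map_apply _ _ p.someVector_ne_zero, Module.Ray.someVector_ray]

/-- The ordered simplex `([v₀], …, [v_k])` of `X₊`, for a generic tuple of vectors that represent
distinct points. -/
def mkSimplex {k : ℕ} (v : Fin (k + 1) → Fin n → K) (hv : ∀ i, v i ≠ 0)
    (hne : ∀ i j, i ≠ j → ¬ SameRay K (v i) (v j))
    (hgen : ∀ s : Finset (Fin (k + 1)), s.card ≤ n → LinearIndepOn K v (s : Set (Fin (k + 1)))) :
    OrdSimplex (genericComplex K n) k :=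
  ⟨⟨fun i => rayOfNeZero K (v i) (hv i), fun i j hij => by
      by_contra h
      exact hne i j h ((ray_eq_iff (hv i) (hv j)).1 hij)⟩, by
    refine ⟨by simp, fun t ht htn => ?_⟩
    obtain ⟨s, -, rfl⟩ := Finset.subset_map_iff.1 ht
    rw [Finset.card_map] at htn
    rw [Finset.coe_map]
    exact LinearIndepOn.image_of_comp (f := fun i => rayOfNeZero K (v i) (hv i))
      (g := fun p : PosProj K n => p.someVector)
      ((linearIndepOn_someVector_iff _ v hv (fun _ => rfl) _).2 (hgen s htn))⟩

end Generic

/-! ### The Euler class `eu₊` and its components -/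

section Euler

variable (K : Type u) [Field K] [LinearOrder K] [IsStrictOrderedRing K] (n : ℕ)

/-- The ring `ℤ`, in the universe of `K` (group cohomology in Mathlib asks for the group and the
coefficient ring to live in the same universe). -/
abbrev ZZ : Type u := ULift.{u} ℤ

/-- The complex `C_* X₊` of `P₊GL₊(n, K)`-modules. -/
abbrev chainsPlus : ChainComplex (Rep.{u} ZZ.{u} (PGLPos K n)) ℕ :=
  chainComplex ZZ.{u} (genericComplex K n) (PGLPos K n)

/-- The coefficient group `U₊ = U_n(X₊)`. -/
abbrev UPlus : Type u := coeffGroup (chainsPlus K n) n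

/-- The vectors `e₁, …, e_n, e₁ + ⋯ + e_a - (e_{a+1} + ⋯ + e_n)`. -/
def symbolVec (a : ℕ) : Fin (n + 1) → Fin n → K :=
  Fin.snoc (α := fun _ => Fin n → K) (fun i => Pi.single i 1) (fun i => if (i : ℕ) < a then 1 else -1)

variable {n}

set_option linter.unusedSectionVars false in
lemma symbolVec_sum (a : ℕ) (f : Fin (n + 1) → K) (m : Fin n) :
    (∑ i, f i • symbolVec K n a i) m =
      f m.castSucc + f (Fin.last n) * if (m : ℕ) < a then 1 else -1 := by
  rw [Fin.sum_univ_castSucc]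
  simp [symbolVec, Finset.sum_apply, Pi.single_apply]

lemma symbolVec_generic (a : ℕ) (s : Finset (Fin (n + 1))) (hs : s.card ≤ n) :
    LinearIndepOn K (symbolVec K n a) (s : Set (Fin (n + 1))) := by
  rw [linearIndepOn_finset_iff]
  intro f hf
  set g : Fin (n + 1) → K := fun i => if i ∈ s then f i else 0 with hg
  have hsum : ∑ i, g i • symbolVec K n a i = 0 := by
    rw [← hf]
    simp [hg, ite_smul, Finset.sum_ite_mem]
  have hcoord : ∀ m : Fin n,
      g m.castSucc + g (Fin.last n) * (if (m : ℕ) < a then 1 else -1) = 0 := fun m => by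
    rw [← symbolVec_sum, hsum]; rfl
  have hlast : g (Fin.last n) = 0 := by
    obtain ⟨j, hj⟩ : ∃ j, j ∉ s := by
      by_contra! h
      have : s = Finset.univ := Finset.eq_univ_iff_forall.2 h
      simp [this] at hs
    have hgj : g j = 0 := by simp [hg, hj]
    induction j using Fin.lastCases with
    | last => exact hgj
    | cast m =>
      have := hcoord m
      rw [hgj] at this
      split_ifs at this <;> simpa using this
  have hall : ∀ i, g i = 0 := fun i => by
    induction i using Fin.lastCases with
    | last => exact hlast
    | cast m => simpa [hlast] using hcoord m
  intro i hi
  simpa [hg, hi] using hall i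

lemma symbolVec_ne_zero (hn : 1 ≤ n) (a : ℕ) (i : Fin (n + 1)) : symbolVec K n a i ≠ 0 := by
  have := symbolVec_generic K a {i} (by simpa using hn)
  rw [Finset.coe_singleton] at this
  exact (linearIndepOn_singleton_iff K).1 this

lemma symbolVec_not_sameRay (hn : 1 ≤ n) (a : ℕ) (ha : a ≤ n / 2) (i j : Fin (n + 1))
    (hij : i ≠ j) : ¬ SameRay K (symbolVec K n a i) (symbolVec K n a j) := by
  intro h
  obtain ⟨c, d, hc, hd, hcd⟩ :=
    h.exists_pos (symbolVec_ne_zero K hn a i) (symbolVec_ne_zero K hn a j)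
  rcases Nat.lt_or_ge 1 n with h2 | h2
  · have hli := symbolVec_generic K a {i, j} ((Finset.card_le_two).trans h2)
    rw [Finset.coe_insert, Finset.coe_singleton, LinearIndepOn.pair_iff _ hij] at hli
    have := hli c (-d) (by rw [hcd]; simp)
    exact hc.ne' this.1
  · obtain rfl : n = 1 := le_antisymm h2 hn
    obtain rfl : a = 0 := by omega
    have h0 := congrFun hcd 0
    have e0 : symbolVec K 1 0 0 0 = 1 := by simp [symbolVec, Fin.snoc]
    have e1 : symbolVec K 1 0 1 0 = -1 := by simp [symbolVec, Fin.snoc]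
    fin_cases i <;> fin_cases j <;> simp_all <;> linarith

/-- The ordered `n`-simplex `([e₁], …, [e_n], [e₁ + ⋯ + e_a - (e_{a+1} + ⋯ + e_n)])` of `X₊`, for
`0 ≤ a ≤ ⌊n/2⌋`. -/
def symbolSimplex (hn : 1 ≤ n) (a : Fin (n / 2 + 1)) : OrdSimplex (genericComplex K n) n :=
  mkSimplex (symbolVec K n a) (symbolVec_ne_zero K hn a)
    (symbolVec_not_sameRay K hn a (Nat.lt_succ_iff.1 a.2)) (symbolVec_generic K a)

/-- The element `a⁺` of `U₊`: the image of the simplex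
`([e₁], …, [e_n], [e₁ + ⋯ + e_a - (e_{a+1} + ⋯ + e_n)])`. -/
def aPlus (hn : 1 ≤ n) (a : Fin (n / 2 + 1)) : UPlus K n :=
  (tautCocycle (chainsPlus K n) n).hom
    (simplexChain ZZ.{u} (PGLPos K n) (symbolSimplex K hn a))

variable {K}

/-- The component `p ∘ T₊ ∈ Hom_G(C_n X₊, ℤ)` of the tautological cocycle `T₊`, for a linear map
`p : U₊ → ℤ`. -/
def cocycleComponent (p : UPlus K n →ₗ[ZZ.{u}] ZZ.{u}) :
    (chainsPlus K n).X n ⟶ Rep.trivial ZZ.{u} (PGLPos K n) ZZ.{u} :=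
  tautCocycle (chainsPlus K n) n ≫ trivialMap p

/-- Chain maps from the bar resolution of the trivial module `ℤ` to `C_* X₊` that respect the
augmentations, that is, extend by the identity of `ℤ` to the augmented complexes. -/
def IsResolutionMap (ψ : Rep.barComplex ZZ.{u} (PGLPos K n) ⟶ chainsPlus K n) : Prop :=
  ψ ≫ augmentationMap ZZ.{u} (genericComplex K n) (PGLPos K n) =
    (Rep.barResolution ZZ.{u} (PGLPos K n)).π

/-- The Euler class `eu₊ = ψ^*[T₊] ∈ Hⁿ(P₊GL₊(n, K), U₊)`. -/
def eulerPlus (ψ : Rep.barComplex ZZ.{u} (PGLPos K n) ⟶ chainsPlus K n) :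
    groupCohomology (Rep.trivial ZZ.{u} (PGLPos K n) (UPlus K n)) n :=
  tautClass ψ n

/-- The component `p_* eu₊ ∈ Hⁿ(P₊GL₊(n, K), ℤ)` of the Euler class, for a linear map
`p : U₊ → ℤ`. -/
def eulerComponent (ψ : Rep.barComplex ZZ.{u} (PGLPos K n) ⟶ chainsPlus K n)
    (p : UPlus K n →ₗ[ZZ.{u}] ZZ.{u}) :
    groupCohomology (Rep.trivial ZZ.{u} (PGLPos K n) ZZ.{u}) n :=
  coeffMap p n (eulerPlus ψ)

/-- The sign of the determinant of `n` vectors in `Kⁿ`, listed as `v₀, …, v_{n-1}`. -/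
def detSign (hn : 1 ≤ n) (v : Fin (n - 1 + 1) → Fin n → K) : ℤ :=
  SignType.sign
    (Matrix.det (Matrix.of fun i : Fin n => v (Fin.cast (Nat.sub_add_cancel hn).symm i)))

end Euler

end Taut

end

/-! An ordered n-simplex of X₊ consists of n + 1 generic vectors of Kⁿ. They satisfy one linear
relation up to scale, and all its coefficients are nonzero. With the Laplace normalisation, the
signs of these coefficients (`vertexSign`) are a complete invariant of the G-orbit
(`exists_act_eq`), and reordering by t permutes the signs and multiplies them all by sgn t. In the
coinvariants, a simplex therefore depends only on its numbers of signs of the two kinds. Exchanging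
these numbers changes its sign, so a balanced simplex (equal numbers, n odd) is killed by 2.

To see what the boundaries add, take N = n + 2 generic vectors of Kⁿ. Their Gale dual is a family of
N plane vectors, and the sign counts of the j-th face are the numbers of plane vectors on the two
sides of the j-th one (`isPlanar_galeArea`, `counts_galeArea`). Sorting the plane vectors by slope
turns these numbers into a walk with steps ±1 from some A to N - A. The symmetry of the endpoints
has two consequences. For each k, as many plane vectors have k others on the left as on the right,
so boundaries impose no relation on unbalanced types (`sum_typeIndicator_face`). If N is odd, the
number of balanced faces is odd, so the balanced class, already killed by 2, is zero
(`plusValue_eq_zero_of_balanced`). Hence the k⁺ form a basis of U₊, with coordinates `typeIndicator`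
(`exists_basis`).

The coboundary of (-1)ⁿ sgn det on a simplex is (-1)ⁿ times the sum of its vertex signs, a
difference of the two counts. On a simplex of type k⁺ this is (n + 1 - k) - k, which is the
coefficient in the relation (`sum_mul_typeIndicator`). Pulling back along ψ makes this coboundary
vanish in group cohomology. A map ψ exists because K is infinite: every finite set of points has a
generic cone point, so C_*X₊ is a resolution of ℤ. -/

noncomputable section

namespace Taut

/-! ### Walks with steps ±1 attached to sign sequences -/

section Walk

/-- The walk attached to a sequence of signs `s`: the `m`-th value counts the indices `i ≥ m` with
positive sign and the indices `i < m` with negative sign. -/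
def signWalk {N : ℕ} (s : Fin N → Prop) (m : ℕ) : ℕ :=
  open Classical in
  (Finset.univ.filter fun i : Fin N => ((m ≤ i) ↔ s i)).card

/-- The walk counts the positive signs at time `0` and the negative ones at time `N`. This symmetry
of the endpoints drives both counting results on plane vectors. -/
lemma signWalk_zero_add {N : ℕ} (s : Fin N → Prop) : signWalk s 0 + signWalk s N = N := by
  classical
  have h : (Finset.univ.filter fun i : Fin N => (N ≤ (i : ℕ) ↔ s i)) =
      Finset.univ.filter fun i : Fin N => ¬ (0 ≤ (i : ℕ) ↔ s i) := by
    ext i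
    simp [i.2.not_ge]
  simp only [signWalk]
  rw [h, Finset.card_filter_add_card_filter_not]
  simp

/-- Between times `j` and `j + 1` only the index `j` changes status, so both values are expressed by
the count over the other indices. -/
lemma signWalk_of_pos {N : ℕ} {s : Fin N → Prop} {j : Fin N} (hj : s j) :
    open Classical in
    signWalk s j = (Finset.univ.filter fun i => i ≠ j ∧ ((j < i) ↔ s i)).card + 1 ∧
    signWalk s (j + 1) = (Finset.univ.filter fun i => i ≠ j ∧ ((j < i) ↔ s i)).card := by
  classical
  constructor
  · rw [signWalk, ← Finset.card_insert_of_notMem (a := j) (by simp)]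
    congr 1
    ext i
    simp only [Finset.mem_filter, Finset.mem_univ, true_and, Finset.mem_insert]
    by_cases hij : i = j
    · subst hij; simp [hj]
    · have : (j : ℕ) ≤ i ↔ j < i := by
        rw [Fin.lt_def]
        have : (i : ℕ) ≠ j := fun h => hij (Fin.ext h)
        omega
      simp [hij, this]
  · rw [signWalk]
    congr 1
    ext i
    simp only [Finset.mem_filter, Finset.mem_univ, true_and]
    by_cases hij : i = j
    · subst hij; simp [hj]
    · have : (j : ℕ) + 1 ≤ i ↔ j < i := by
        rw [Fin.lt_def]; omega
      simp [hij, this]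

lemma signWalk_of_neg {N : ℕ} {s : Fin N → Prop} {j : Fin N} (hj : ¬ s j) :
    open Classical in
    signWalk s j = (Finset.univ.filter fun i => i ≠ j ∧ ((j < i) ↔ s i)).card ∧
    signWalk s (j + 1) = (Finset.univ.filter fun i => i ≠ j ∧ ((j < i) ↔ s i)).card + 1 := by
  classical
  constructor
  · rw [signWalk]
    congr 1
    ext i
    simp only [Finset.mem_filter, Finset.mem_univ, true_and]
    by_cases hij : i = j
    · subst hij; simp [hj]
    · have : (j : ℕ) ≤ i ↔ j < i := by
        rw [Fin.lt_def]
        have : (i : ℕ) ≠ j := fun h => hij (Fin.ext h)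
        omega
      simp [hij, this]
  · rw [signWalk, ← Finset.card_insert_of_notMem (a := j) (by simp)]
    congr 1
    ext i
    simp only [Finset.mem_filter, Finset.mem_univ, true_and, Finset.mem_insert]
    by_cases hij : i = j
    · subst hij; simp [hj]
    · have : (j : ℕ) + 1 ≤ i ↔ j < i := by
        rw [Fin.lt_def]; omega
      simp [hij, this]

end Walk

/-! ### Plane vectors and the numbers of vectors on either side of each -/

section PlaneVectors

set_option linter.unusedSectionVars false

variable {K : Type*} [Field K] [LinearOrder K] [IsStrictOrderedRing K] {N : ℕ}

/-- The number of vectors to the right of the `j`-th one, for a family with oriented areas `e`. -/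
def negCount (e : Fin N → Fin N → K) (j : Fin N) : ℕ := (Finset.univ.filter fun i => e j i < 0).card

/-- The number of vectors to the left of the `j`-th one, for a family with oriented areas `e`. -/
def posCount (e : Fin N → Fin N → K) (j : Fin N) : ℕ := (Finset.univ.filter fun i => 0 < e j i).card

lemma negCount_add_posCount {e : Fin N → Fin N → K} {j : Fin N} (h0 : e j j = 0)
    (hne : ∀ i, i ≠ j → e j i ≠ 0) : negCount e j + posCount e j + 1 = N := by
  have h : (Finset.univ.filter fun i => e j i < 0) ∪ (Finset.univ.filter fun i => 0 < e j i) =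
      Finset.univ.erase j := by
    ext i
    simp only [Finset.mem_union, Finset.mem_filter, Finset.mem_univ, true_and, Finset.mem_erase,
      and_true]
    constructor
    · rintro (h | h) rfl <;> simp [h0] at h
    · intro h
      exact lt_or_gt_of_ne (hne i h)
  have h2 := congrArg Finset.card h
  rw [Finset.card_union_of_disjoint (Finset.disjoint_filter.2 fun i _ h h' => lt_asymm h h'),
    Finset.card_erase_of_mem (Finset.mem_univ _), Finset.card_univ, Fintype.card_fin] at h2
  have := j.pos
  simp only [negCount, posCount]
  omega

/-- An ordered field is infinite, so some `t` avoids the finitely many ratios `-r i / r' i`.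
Geometrically, some line through the origin contains none of the vectors. -/
lemma exists_add_mul_ne_zero {ι : Type*} [Fintype ι] (r r' : ι → K)
    (h : ∀ i, r i ≠ 0 ∨ r' i ≠ 0) : ∃ t : K, ∀ i, r i + t * r' i ≠ 0 := by
  classical
  obtain ⟨t, ht⟩ := Infinite.exists_notMem_finset (Finset.univ.image fun i => - r i / r' i)
  refine ⟨t, fun i hi => ht ?_⟩
  have h' : r' i ≠ 0 := by
    intro h0
    rw [h0, mul_zero, add_zero] at hi
    rcases h i with h | h
    exacts [h hi, h h0]
  refine Finset.mem_image.2 ⟨i, Finset.mem_univ _, ?_⟩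
  rw [div_eq_iff h']
  linear_combination -hi

/-- Pairwise independent vectors `(r j, r' j)` of the plane, sorted by slope, define a walk whose
steps are determined by the numbers of vectors on the two sides of each vector. -/
lemma exists_walk (r r' : Fin N → K) (hN : 2 ≤ N)
    (hne : ∀ i j, i ≠ j → r j * r' i - r' j * r i ≠ 0) :
    ∃ (π : Equiv.Perm (Fin N)) (A : ℕ → ℕ), A 0 + A N = N ∧ ∀ j : Fin N,
      (A j = posCount (fun j i => r j * r' i - r' j * r i) (π j) + 1 ∧
        A (j + 1) = posCount (fun j i => r j * r' i - r' j * r i) (π j)) ∨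
      (A j = negCount (fun j i => r j * r' i - r' j * r i) (π j) ∧
        A (j + 1) = negCount (fun j i => r j * r' i - r' j * r i) (π j) + 1) := by
  classical
  have : Nontrivial (Fin N) := Fin.nontrivial_iff_two_le.2 hN
  obtain ⟨t, ht⟩ := exists_add_mul_ne_zero r r' fun i => by
    obtain ⟨j, hj⟩ := exists_ne i
    by_contra! h
    exact hne i j hj.symm (by rw [h.1, h.2]; ring)
  -- This shear preserves oriented areas and makes all first coordinates nonzero, so that slopes `r'
  -- i / q i` are defined.
  set q : Fin N → K := fun i => r i + t * r' i with hq
  change ∀ i, q i ≠ 0 at ht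
  have hdet : ∀ j i, r j * r' i - r' j * r i = q j * r' i - r' j * q i := fun j i => by
    simp only [hq]; ring
  simp only [hdet] at hne ⊢
  set x : Fin N → K := fun i => r' i / q i with hx
  have hdet' : ∀ j i, q j * r' i - r' j * q i = q j * q i * (x i - x j) := fun j i => by
    have h1 := ht i
    have h2 := ht j
    simp only [hx]
    field_simp
  simp only [hdet'] at hne ⊢
  set π := Tuple.sort x with hπ
  have hmono : StrictMono (x ∘ π) := by
    refine (Tuple.monotone_sort x).strictMono_of_injective (Function.Injective.comp ?_ π.injective)
    intro i j hij
    by_contra h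
    exact hne i j h (by rw [hij]; ring)
  -- The area of the pair (j, i) is `q j * q i` times a difference of slopes. After sorting, its
  -- sign depends on the half-planes containing the two vectors and on the order of `i` and `j`,
  -- which is what `signWalk` records.
  refine ⟨π, signWalk fun i => 0 < q (π i), signWalk_zero_add _, fun j => ?_⟩
  have hcard : ∀ (P : Fin N → Prop) [DecidablePred P],
      (Finset.univ.filter P).card = (Finset.univ.filter fun i => P (π i)).card := fun P _ => by
    refine (Finset.card_bij (fun i _ => π i) (by simp) (by simp) fun i hi => ?_).symm
    exact ⟨π.symm i, by simpa using hi, by simp⟩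
  have hcmp : ∀ i, (0 < x (π i) - x (π j) ↔ j < i) ∧ (x (π i) - x (π j) < 0 ↔ i < j) := fun i => by
    rw [sub_pos, sub_neg]
    exact ⟨hmono.lt_iff_lt, hmono.lt_iff_lt⟩
  have hprod : ∀ a d : K, a ≠ 0 → d ≠ 0 → (0 < a * d ↔ (0 < d ↔ 0 < a)) := fun a d ha hd => by
    rcases lt_or_gt_of_ne ha with h | h <;> rcases lt_or_gt_of_ne hd with h' | h'
    · simp [mul_pos_of_neg_of_neg h h', h.not_gt, h'.not_gt]
    · simp [(mul_neg_of_neg_of_pos h h').not_gt, h.not_gt, h']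
    · simp [(mul_neg_of_pos_of_neg h h').not_gt, h, h'.not_gt]
    · simp [mul_pos h h', h, h']
  have hdiff : ∀ i, i ≠ j → x (π i) - x (π j) ≠ 0 := fun i hij =>
    sub_ne_zero.2 fun h => hij (hmono.injective h)
  rcases lt_or_gt_of_ne (ht (π j)) with hs | hs
  · right
    have key : negCount (fun j i => q j * q i * (x i - x j)) (π j) =
        (Finset.univ.filter fun i => i ≠ j ∧ ((j < i) ↔ 0 < q (π i))).card := by
      rw [negCount, hcard (fun i => q (π j) * q i * (x i - x (π j)) < 0)]
      congr 1
      ext i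
      simp only [Finset.mem_filter, Finset.mem_univ, true_and]
      by_cases hij : i = j
      · simp [hij]
      · rw [mul_assoc, mul_neg_iff, hprod _ _ (ht (π i)) (hdiff i hij), (hcmp i).1]
        simp [hij, hs, hs.not_gt]
    rw [key]
    obtain ⟨h1, h2⟩ := signWalk_of_neg (s := fun i => 0 < q (π i)) hs.not_gt
    exact ⟨by convert h1, by convert h2⟩
  · left
    have key : posCount (fun j i => q j * q i * (x i - x j)) (π j) =
        (Finset.univ.filter fun i => i ≠ j ∧ ((j < i) ↔ 0 < q (π i))).card := by
      rw [posCount, hcard (fun i => 0 < q (π j) * q i * (x i - x (π j)))]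
      congr 1
      ext i
      simp only [Finset.mem_filter, Finset.mem_univ, true_and]
      by_cases hij : i = j
      · simp [hij]
      · rw [mul_assoc, mul_pos_iff_of_pos_left hs, hprod _ _ (ht (π i)) (hdiff i hij), (hcmp i).1]
        simp [hij]
    rw [key]
    obtain ⟨h1, h2⟩ := signWalk_of_pos (s := fun i => 0 < q (π i)) hs
    exact ⟨by convert h1, by convert h2⟩

/-- A family of oriented areas of pairwise independent plane vectors, up to a common factor. -/
def IsPlanar (e : Fin N → Fin N → K) : Prop :=
  ∃ (μ : K) (r r' : Fin N → K), μ ≠ 0 ∧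
    (∀ i j, i ≠ j → r j * r' i - r' j * r i ≠ 0) ∧ ∀ j i, r j * r' i - r' j * r i = μ * e j i

lemma IsPlanar.apply_self {e : Fin N → Fin N → K} (h : IsPlanar e) (j : Fin N) : e j j = 0 := by
  obtain ⟨μ, r, r', hμ, -, he⟩ := h
  have := he j j
  rw [mul_comm, sub_self, eq_comm, mul_eq_zero] at this
  exact this.resolve_left hμ

lemma IsPlanar.apply_ne_zero {e : Fin N → Fin N → K} (h : IsPlanar e) {j i : Fin N}
    (hij : i ≠ j) : e j i ≠ 0 := by
  obtain ⟨μ, r, r', hμ, hne, he⟩ := h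
  intro h0
  exact hne i j hij (by rw [he, h0, mul_zero])

lemma IsPlanar.exists_walk {e : Fin N → Fin N → K} (h : IsPlanar e) (hN : 2 ≤ N) :
    ∃ (π : Equiv.Perm (Fin N)) (A : ℕ → ℕ), A 0 + A N = N ∧ ∀ j : Fin N,
      (A j = posCount e (π j) + 1 ∧ A (j + 1) = posCount e (π j)) ∨
      (A j = negCount e (π j) ∧ A (j + 1) = negCount e (π j) + 1) := by
  obtain ⟨μ, r, r', hμ, hne, he⟩ := h
  rcases lt_or_gt_of_ne hμ with hμ | hμ
  -- A negative factor is made positive by exchanging the two coordinates, which reverses the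
  -- orientation of the plane.
  · have hne' : ∀ i j, i ≠ j → r' j * r i - r j * r' i ≠ 0 := fun i j hij h0 =>
      hne i j hij (by linear_combination -h0)
    have he' : ∀ j i, r' j * r i - r j * r' i = -μ * e j i := fun j i => by
      linear_combination - he j i
    have := Taut.exists_walk r' r hN hne'
    simpa only [posCount, negCount, he', mul_pos_iff_of_pos_left (neg_pos.2 hμ),
      ← not_le, mul_nonneg_iff_of_pos_left (neg_pos.2 hμ)] using this
  · have := Taut.exists_walk r r' hN hne
    simpa only [posCount, negCount, he, mul_pos_iff_of_pos_left hμ,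
      ← not_le, mul_nonneg_iff_of_pos_left hμ] using this

lemma IsPlanar.counts_add {e : Fin N → Fin N → K} (h : IsPlanar e) (j : Fin N) :
    negCount e j + posCount e j + 1 = N :=
  negCount_add_posCount (h.apply_self j) fun _ hij => h.apply_ne_zero hij

/-- As many vectors have `k` vectors on their left as have `k` vectors on their right. -/
lemma IsPlanar.sum_sub_eq_zero {e : Fin N → Fin N → K} (h : IsPlanar e) (hN : 2 ≤ N)
    (f : ℕ → ℤ) : ∑ j, (f (negCount e j) - f (posCount e j)) = 0 := by
  obtain ⟨π, A, hA, hstep⟩ := h.exists_walk hN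
  set H : ℕ → ℤ := fun a => ∑ i ∈ Finset.range a, f i with hH
  have hHs : ∀ a, H (a + 1) = H a + f a := fun a => Finset.sum_range_succ f a
  -- `H` is a discrete antiderivative of `f`. Its symmetrisation `Ψ` changes by the desired summand
  -- along each step and is invariant under a ↦ N - a, so the telescoping sum has equal ends.
  set Ψ : ℕ → ℤ := fun a => H a + H (N - a) with hΨ
  have key : ∀ j : Fin N, f (negCount e (π j)) - f (posCount e (π j)) =
      Ψ (A (j + 1)) - Ψ (A j) := fun j => by
    have hc := h.counts_add (π j)
    rcases hstep j with ⟨h1, h2⟩ | ⟨h1, h2⟩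
    · have e1 : N - posCount e (π j) = negCount e (π j) + 1 := by omega
      have e2 : N - (posCount e (π j) + 1) = negCount e (π j) := by omega
      simp only [hΨ, h1, h2, e1, e2, hHs]
      ring
    · have e1 : N - negCount e (π j) = posCount e (π j) + 1 := by omega
      have e2 : N - (negCount e (π j) + 1) = posCount e (π j) := by omega
      simp only [hΨ, h1, h2, e1, e2, hHs]
      ring
  rw [← Equiv.sum_comp π, Finset.sum_congr rfl fun j _ => key j,
    Fin.sum_univ_eq_sum_range (fun j => Ψ (A (j + 1)) - Ψ (A j)) N, Finset.sum_range_sub fun i => Ψ (A i)]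
  have e1 : N - A N = A 0 := by omega
  have e2 : N - A 0 = A N := by omega
  simp only [hΨ, e1, e2]
  ring

/-- Among an odd number of vectors, an odd number is balanced, that is, has equally many vectors on
both sides. -/
lemma IsPlanar.odd_card_balanced {e : Fin N → Fin N → K} (h : IsPlanar e) (hN : 2 ≤ N)
    (hodd : Odd N) : Odd (Finset.univ.filter fun j => negCount e j = posCount e j).card := by
  obtain ⟨π, A, hA, hstep⟩ := h.exists_walk hN
  obtain ⟨M, hM⟩ := hodd
  -- With N = 2M + 1, a vector is balanced exactly when its step crosses between `M` and `M + 1`.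
  -- The endpoints `A 0` and `N - A 0` lie on opposite sides, so the number of crossings is odd.
  set Ψ : ℕ → ZMod 2 := fun a => if M < a then 1 else 0 with hΨ
  have key : ∀ j : Fin N, (if negCount e (π j) = posCount e (π j) then (1 : ZMod 2) else 0) =
      Ψ (A (j + 1)) - Ψ (A j) := fun j => by
    have hc := h.counts_add (π j)
    rcases hstep j with ⟨h1, h2⟩ | ⟨h1, h2⟩ <;> simp only [hΨ, h1, h2] <;> split_ifs <;>
      first | omega | simp
  rw [← ZMod.natCast_eq_one_iff_odd, Finset.card_filter, Nat.cast_sum, ← Equiv.sum_comp π]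
  push_cast
  rw [Finset.sum_congr rfl fun j _ => key j,
    Fin.sum_univ_eq_sum_range (fun j => Ψ (A (j + 1)) - Ψ (A j)) N, Finset.sum_range_sub fun i => Ψ (A i)]
  simp only [hΨ]
  split_ifs <;> first | omega | simp

end PlaneVectors

/-! ### Linear relations between generic vectors and Gale duality -/

section Relations

variable {K : Type*} [Field K] {d : ℕ}

/-- The coefficients of the Laplace relation between `d + 1` vectors of `K^d`. -/
def relCoeff (v : Fin (d + 1) → Fin d → K) (i : Fin (d + 1)) : K :=
  (-1) ^ (i : ℕ) * Matrix.det (Matrix.of fun j => v (i.succAbove j))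

/-- In each coordinate `l` this is the expansion along the first column of a determinant in which
column `l` of the vectors appears twice. -/
lemma sum_relCoeff_smul (v : Fin (d + 1) → Fin d → K) : ∑ i, relCoeff v i • v i = 0 := by
  ext l
  set M : Matrix (Fin (d + 1)) (Fin (d + 1)) K :=
    Matrix.of fun i => Fin.cons (v i l) (v i) with hM
  have h0 : M.det = 0 := Matrix.det_zero_of_column_eq (Fin.succ_ne_zero l).symm fun k => by
    simp [hM]
  rw [Matrix.det_succ_column_zero] at h0
  rw [Pi.zero_apply, ← h0, Finset.sum_apply]
  refine Finset.sum_congr rfl fun i _ => ?_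
  have : M.submatrix i.succAbove Fin.succ = Matrix.of fun j => v (i.succAbove j) := by
    ext a b
    simp [hM]
  rw [this, relCoeff, Pi.smul_apply, smul_eq_mul]
  simp only [hM, Matrix.of_apply, Fin.cons_zero]
  ring

lemma det_of_ne_zero {v : Fin d → Fin d → K} :
    (Matrix.of v).det ≠ 0 ↔ LinearIndependent K v := by
  rw [← isUnit_iff_ne_zero, ← Matrix.isUnit_iff_isUnit_det,
    ← Matrix.linearIndependent_rows_iff_isUnit]
  rfl

lemma relCoeff_ne_zero_iff {v : Fin (d + 1) → Fin d → K} {i : Fin (d + 1)} :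
    relCoeff v i ≠ 0 ↔ LinearIndependent K fun j => v (i.succAbove j) := by
  rw [← det_of_ne_zero, relCoeff, mul_ne_zero_iff_left]
  exact pow_ne_zero _ (by simp)

/-- A relation between `d + 1` generic vectors of `K^d` is a multiple of the Laplace relation. -/
lemma exists_eq_mul_relCoeff {v : Fin (d + 1) → Fin d → K} (hv : relCoeff v 0 ≠ 0)
    {x : Fin (d + 1) → K} (hx : ∑ i, x i • v i = 0) : ∃ c, ∀ i, x i = c * relCoeff v i := by
  refine ⟨x 0 / relCoeff v 0, fun i => ?_⟩
  set y : Fin (d + 1) → K := fun i => x i - x 0 / relCoeff v 0 * relCoeff v i with hy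
  have hy0 : y 0 = 0 := by simp [hy, div_mul_cancel₀ _ hv]
  have hsum : ∑ i, y i • v i = 0 := by
    simp only [hy, sub_smul, Finset.sum_sub_distrib, hx, mul_smul, ← Finset.smul_sum,
      sum_relCoeff_smul]
    simp
  rw [Fin.sum_univ_succ, hy0, zero_smul, zero_add] at hsum
  have hli := relCoeff_ne_zero_iff.1 hv
  simp only [Fin.succAbove_zero] at hli
  have hy' := Fintype.linearIndependent_iff.1 hli _ hsum
  have : y i = 0 := by
    induction i using Fin.cases with
    | zero => exact hy0
    | succ j => exact hy' j
  exact sub_eq_zero.1 this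

/-- The oriented areas of the pairs of vectors of the Gale dual of `d + 2` vectors of `K^d`. -/
def galeArea (v : Fin (d + 2) → Fin d → K) (j : Fin (d + 2)) : Fin (d + 2) → K :=
  j.insertNth (α := fun _ => K) 0
    fun i => (-1) ^ (j : ℕ) * relCoeff (fun l => v (j.succAbove l)) i

@[simp]
lemma galeArea_self (v : Fin (d + 2) → Fin d → K) (j : Fin (d + 2)) : galeArea v j j = 0 := by
  simp [galeArea]

@[simp]
lemma galeArea_succAbove (v : Fin (d + 2) → Fin d → K) (j : Fin (d + 2)) (i : Fin (d + 1)) :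
    galeArea v j (j.succAbove i) =
      (-1) ^ (j : ℕ) * relCoeff (fun l => v (j.succAbove l)) i := by
  simp [galeArea]

lemma sum_galeArea_smul (v : Fin (d + 2) → Fin d → K) (j : Fin (d + 2)) :
    ∑ i, galeArea v j i • v i = 0 := by
  rw [Fin.sum_univ_succAbove _ j]
  simp only [galeArea_self, zero_smul, zero_add, galeArea_succAbove, mul_smul, ← Finset.smul_sum]
  rw [sum_relCoeff_smul (fun l => v (j.succAbove l)), smul_zero]

/-- The sign cancellation behind ∂∂ = 0: omitting two vertices in the two possible orders gives
opposite signs. -/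
lemma neg_one_pow_succAbove_mul_predAbove {k : ℕ} (j : Fin (k + 2)) (i : Fin (k + 1)) :
    (-1 : ℤ) ^ (j : ℕ) * (-1) ^ (i : ℕ) =
      - ((-1) ^ (j.succAbove i : ℕ) * (-1) ^ (i.predAbove j : ℕ)) := by
  rcases lt_or_ge i.castSucc j with h | h
  · rw [Fin.succAbove_of_castSucc_lt _ _ h, Fin.predAbove_of_castSucc_lt _ _ h]
    obtain ⟨m, hm⟩ : ∃ m, (j : ℕ) = m + 1 := ⟨j - 1, by
      have : (i : ℕ) < j := h
      omega⟩
    simp [hm, pow_succ]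
    ring
  · rw [Fin.succAbove_of_le_castSucc _ _ h, Fin.predAbove_of_le_castSucc _ _ h]
    simp [pow_succ]
    ring

/-- Both entries are, up to sign, the minor omitting `i` and `j`. The factor (-1)^j in `galeArea` is
there to make the matrix antisymmetric. -/
lemma galeArea_swap (v : Fin (d + 2) → Fin d → K) (i j : Fin (d + 2)) :
    galeArea v i j = - galeArea v j i := by
  rcases eq_or_ne i j with rfl | hij
  · simp
  obtain ⟨i, rfl⟩ := Fin.exists_succAbove_eq hij
  have e : (j.succAbove i).succAbove (i.predAbove j) = j := by
    simp [Fin.succAbove_succAbove_predAbove]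
  have h := galeArea_succAbove v (j.succAbove i) (i.predAbove j)
  rw [e] at h
  have hs := congrArg (Int.cast (R := K)) (neg_one_pow_succAbove_mul_predAbove j i)
  push_cast at hs
  rw [h, galeArea_succAbove, relCoeff, relCoeff]
  simp only [Fin.succAbove_succAbove_succAbove_predAbove]
  rw [← mul_assoc, ← mul_assoc, hs]
  ring

/-- The space of relations between d + 2 generic vectors is a plane, and rows 0 and 1 of `galeArea`
serve as its coordinates. The 2 × 2 minor with columns `j` and `i` is, as a function of `i`, a
relation vanishing at `j`. It is therefore proportional to row `j`, and antisymmetry forces the same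
factor for all `j`. -/
lemma isPlanar_galeArea {v : Fin (d + 2) → Fin d → K}
    (hv : ∀ j i, relCoeff (fun l => v (Fin.succAbove j l)) i ≠ 0) : IsPlanar (galeArea v) := by
  have hne : ∀ i j, i ≠ j → galeArea v j i ≠ 0 := fun i j hij => by
    obtain ⟨i, rfl⟩ := Fin.exists_succAbove_eq hij
    rw [galeArea_succAbove]
    exact mul_ne_zero (pow_ne_zero _ (by simp)) (hv j i)
  set x : Fin (d + 2) → Fin (d + 2) → K := fun j i =>
    galeArea v 0 j * galeArea v 1 i - galeArea v 1 j * galeArea v 0 i with hx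
  have hrel : ∀ j, ∃ c, ∀ i, x j i = c * galeArea v j i := fun j => by
    have hsum : ∑ i, x j i • v i = 0 := by
      simp only [hx, sub_smul, Finset.sum_sub_distrib, mul_smul, ← Finset.smul_sum,
        sum_galeArea_smul]
      simp
    have hxj : x j j = 0 := by simp [hx, mul_comm]
    rw [Fin.sum_univ_succAbove _ j, hxj, zero_smul, zero_add] at hsum
    obtain ⟨c, hc⟩ := exists_eq_mul_relCoeff (hv j 0) hsum
    refine ⟨(-1) ^ (j : ℕ) * c, fun i => ?_⟩
    rcases eq_or_ne i j with rfl | hij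
    · simp [hxj]
    obtain ⟨i, rfl⟩ := Fin.exists_succAbove_eq hij
    rw [hc, galeArea_succAbove]
    have : ((-1 : K) ^ (j : ℕ)) * (-1) ^ (j : ℕ) = 1 := by
      rw [← mul_pow]; simp
    linear_combination (-c * relCoeff (fun l => v (j.succAbove l)) i) * this
  choose c hc using hrel
  have hcc : ∀ j, c j = c 0 := fun j => by
    rcases eq_or_ne j 0 with rfl | hj
    · rfl
    have h1 := hc j 0
    have h2 := hc 0 j
    rw [galeArea_swap] at h1
    refine mul_right_cancel₀ (hne j 0 hj) ?_
    rw [← h2, ← neg_inj, ← mul_neg, ← h1]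
    simp only [hx]
    ring
  have hc0 : c 0 ≠ 0 := fun h => by
    have := hc 0 1
    simp only [hx, galeArea_self, h, zero_mul, zero_sub, neg_eq_zero, mul_eq_zero] at this
    rcases this with h | h
    · exact hne 0 1 (by simp) h
    · exact hne 1 0 (by simp) h
  refine ⟨c 0, galeArea v 0, galeArea v 1, hc0, fun i j hij => ?_, fun j i => ?_⟩
  · have := hc j i
    simp only [hx] at this
    rw [this, hcc]
    exact mul_ne_zero hc0 (hne i j hij)
  · rw [← hcc j]
    exact hc j i

end Relations

/-! ### Vertex signs of an n-simplex and classification of orbits -/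

section Orientation

set_option linter.unusedSectionVars false

variable {K : Type u} [Field K] [LinearOrder K] [IsStrictOrderedRing K] {n k m : ℕ}

/-- The orientation, `1`, `0` or `-1`, of `n` points of `P₊ⁿ⁻¹(K)`. -/
def orient (p : Fin n → PosProj K n) : ℤ :=
  SignType.sign (Matrix.det (Matrix.of fun i => (p i).someVector))

lemma exists_pos_smul_eq_someVector (p : PosProj K n) {v : Fin n → K} (hv : v ≠ 0)
    (h : p = rayOfNeZero K v hv) : ∃ c : K, 0 < c ∧ p.someVector = c • v := by
  have h1 : SameRay K p.someVector v := by
    rw [← ray_eq_iff p.someVector_ne_zero hv, Module.Ray.someVector_ray, h]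
  obtain ⟨a, b, ha, hb, hab⟩ := h1.exists_pos p.someVector_ne_zero hv
  exact ⟨a⁻¹ * b, mul_pos (inv_pos.2 ha) hb, by
    rw [mul_smul, ← hab, smul_smul, inv_mul_cancel₀ ha.ne', one_smul]⟩

lemma det_of_smul (c : Fin n → K) (v : Fin n → Fin n → K) :
    (Matrix.of fun i => c i • v i).det = (∏ i, c i) * (Matrix.of v).det :=
  Matrix.det_mul_column c (Matrix.of v)

lemma orient_eq_of_rep (p : Fin n → PosProj K n) (v : Fin n → Fin n → K) (hv : ∀ i, v i ≠ 0)
    (h : ∀ i, p i = rayOfNeZero K (v i) (hv i)) :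
    orient p = SignType.sign (Matrix.det (Matrix.of v)) := by
  choose c hc hcv using fun i => exists_pos_smul_eq_someVector (p i) (hv i) (h i)
  simp only [orient, hcv]
  rw [det_of_smul, sign_mul, sign_pos (Finset.prod_pos fun i _ => hc i), one_mul]

lemma orient_comp_perm (p : Fin n → PosProj K n) (t : Equiv.Perm (Fin n)) :
    orient (fun i => p (t i)) = Equiv.Perm.sign t * orient p := by
  have h : (Matrix.of fun i => (p (t i)).someVector).det =
      Equiv.Perm.sign t * (Matrix.of fun i => (p i).someVector).det :=
    Matrix.det_permute t (Matrix.of fun i => (p i).someVector)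
  rw [orient, orient, h]
  rcases Int.units_eq_one_or (Equiv.Perm.sign t) with ht | ht <;> simp [ht, Left.sign_neg]

/-- This is where the positivity of the determinants of elements of GL₊ enters. -/
lemma orient_smul (g : PGLPos K n) (p : Fin n → PosProj K n) :
    orient (fun i => g • p i) = orient p := by
  induction g using QuotientGroup.induction_on with
  | H g =>
    have hne : ∀ i, linEquiv K n g (p i).someVector ≠ 0 := fun i =>
      (linEquiv K n g).map_ne_zero_iff.2 (p i).someVector_ne_zero
    rw [orient_eq_of_rep _ (fun i => linEquiv K n g (p i).someVector) hne fun i => by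
      rw [mk_smul_ray, ← Module.Ray.map_apply _ _ (p i).someVector_ne_zero,
        Module.Ray.someVector_ray]]
    have h : Matrix.of (fun i => linEquiv K n g (p i).someVector) =
        (Matrix.of fun i => (p i).someVector) *
          ((g : Matrix.GeneralLinearGroup (Fin n) K) : Matrix (Fin n) (Fin n) K).transpose := by
      ext i j
      simp [linEquiv_apply, Matrix.mul_apply, Matrix.mulVec, dotProduct, mul_comm]
    have hg : 0 < ((g : Matrix.GeneralLinearGroup (Fin n) K) : Matrix (Fin n) (Fin n) K).det := g.2
    rw [h, Matrix.det_mul, Matrix.det_transpose, sign_mul, sign_pos hg, mul_one, orient]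

/-- Vectors that represent the vertices of a simplex of `X₊`. -/
def OrdSimplex.vec (σ : OrdSimplex (genericComplex K n) k) (i : Fin (k + 1)) : Fin n → K :=
  (σ.1 i).someVector

lemma OrdSimplex.linearIndepOn_vec (σ : OrdSimplex (genericComplex K n) k)
    (s : Finset (Fin (k + 1))) (hs : s.card ≤ n) : LinearIndepOn K σ.vec (s : Set (Fin (k + 1))) := by
  have h := σ.2.2 (s.map σ.1) (Finset.map_subset_map.2 (Finset.subset_univ _)) (by simpa using hs)
  rw [Finset.coe_map] at h
  exact h.comp_of_image σ.1.injective.injOn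

lemma OrdSimplex.linearIndependent_vec (σ : OrdSimplex (genericComplex K n) k) (hk : k + 1 ≤ n) :
    LinearIndependent K σ.vec := by
  have := σ.linearIndepOn_vec Finset.univ (by simpa using hk)
  rwa [Finset.coe_univ, linearIndepOn_univ_iff] at this

/-- The signs of the coefficients of the linear relation between the vertices of an `n`-simplex
of `X₊`, oriented by the ordering of the vertices. -/
def vertexSign (σ : OrdSimplex (genericComplex K (m + 1)) (m + 1)) (i : Fin (m + 2)) : ℤ :=
  (-1) ^ (i : ℕ) * orient (σ.face i).1

lemma relCoeff_vec_ne_zero (σ : OrdSimplex (genericComplex K (m + 1)) (m + 1)) (i : Fin (m + 2)) :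
    relCoeff σ.vec i ≠ 0 :=
  relCoeff_ne_zero_iff.2 ((σ.face i).linearIndependent_vec le_rfl)

/-- Allows computing with explicit vectors, such as `symbolVec`, in place of the chosen
representatives. -/
lemma vertexSign_eq_sign_of_rep (σ : OrdSimplex (genericComplex K (m + 1)) (m + 1))
    (v : Fin (m + 2) → Fin (m + 1) → K) (hv : ∀ i, v i ≠ 0)
    (h : ∀ i, σ.1 i = rayOfNeZero K (v i) (hv i)) (i : Fin (m + 2)) :
    vertexSign σ i = SignType.sign (relCoeff v i) := by
  have hf : orient (σ.face i).1 = SignType.sign (Matrix.of fun j => v (i.succAbove j)).det :=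
    orient_eq_of_rep _ (fun j => v (i.succAbove j)) (fun j => hv _) fun j => h _
  rw [vertexSign, relCoeff, hf, sign_mul]
  rcases neg_one_pow_eq_or ℤ (i : ℕ) with h | h
  · have h' := congrArg (Int.cast (R := K)) h
    push_cast at h'
    rw [h, h']
    simp
  · have h' := congrArg (Int.cast (R := K)) h
    push_cast at h'
    rw [h, h']
    simp

lemma vertexSign_eq_sign (σ : OrdSimplex (genericComplex K (m + 1)) (m + 1)) (i : Fin (m + 2)) :
    vertexSign σ i = SignType.sign (relCoeff σ.vec i) :=
  vertexSign_eq_sign_of_rep σ σ.vec (fun i => (σ.1 i).someVector_ne_zero)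
    (fun i => ((σ.1 i).someVector_ray).symm) i

lemma vertexSign_eq_one_or (σ : OrdSimplex (genericComplex K (m + 1)) (m + 1)) (i : Fin (m + 2)) :
    vertexSign σ i = 1 ∨ vertexSign σ i = -1 := by
  rw [vertexSign_eq_sign]
  rcases lt_or_gt_of_ne (relCoeff_vec_ne_zero σ i) with h | h
  · right; rw [sign_neg h]; rfl
  · left; rw [sign_pos h]; rfl

/-- The global factor sgn t comes from the Laplace normalisation of the relation. Because of it, an
odd reordering exchanges the numbers of positive and negative vertices. -/
lemma vertexSign_perm (σ : OrdSimplex (genericComplex K (m + 1)) (m + 1))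
    (t : Equiv.Perm (Fin (m + 2))) (i : Fin (m + 2)) :
    vertexSign (σ.perm t) i = Equiv.Perm.sign t * vertexSign σ (t i) := by
  obtain ⟨s, hs, hsign⟩ := exists_facePerm t i
  have h : (fun j => ((σ.perm t).face i).1 j) = fun j => (σ.face (t i)).1 (s j) := by
    ext j : 1
    simp [hs]
  rw [vertexSign, vertexSign]
  change _ * orient (fun j => ((σ.perm t).face i).1 j) = _
  rw [h, orient_comp_perm, ← mul_assoc, hsign, mul_assoc]

lemma vertexSign_act (σ : OrdSimplex (genericComplex K (m + 1)) (m + 1))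
    (g : PGLPos K (m + 1)) (i : Fin (m + 2)) : vertexSign (σ.act g) i = vertexSign σ i := by
  rw [vertexSign, vertexSign]
  congr 1
  exact orient_smul g _

lemma div_pos_of_sign_eq {x y : K} (hx : x ≠ 0) (h : SignType.sign x = SignType.sign y) :
    0 < y / x := by
  rcases lt_or_gt_of_ne hx with hx | hx
  · rw [sign_neg hx, eq_comm, sign_eq_neg_one_iff] at h
    exact div_pos_of_neg_of_neg h hx
  · rw [sign_pos hx, eq_comm, sign_eq_one_iff] at h
    exact div_pos h hx

/-- Two `n`-simplices of `X₊` with the same vertex signs lie in the same orbit. -/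
lemma exists_act_eq {σ τ : OrdSimplex (genericComplex K (m + 1)) (m + 1)}
    (h : ∀ i, vertexSign σ i = vertexSign τ i) : ∃ g : PGLPos K (m + 1), σ.act g = τ := by
  -- Rescaling the i-th vector of `τ` by `a i`, positive because the signs agree, gives both
  -- families the same relation. The linear map matching the vectors of index at least 1 then also
  -- matches those of index 0.
  set a : Fin (m + 2) → K := fun i => relCoeff τ.vec i / relCoeff σ.vec i with ha
  have hlσ := relCoeff_vec_ne_zero σ
  have hlτ := relCoeff_vec_ne_zero τ
  have hsgn : ∀ i, SignType.sign (relCoeff σ.vec i) = SignType.sign (relCoeff τ.vec i) := fun i => by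
    have := h i
    rw [vertexSign_eq_sign, vertexSign_eq_sign] at this
    revert this
    generalize SignType.sign (relCoeff σ.vec i) = s
    generalize SignType.sign (relCoeff τ.vec i) = s'
    revert s s'
    decide
  have hapos : ∀ i, 0 < a i := fun i =>
    div_pos_of_sign_eq (hlσ i) (hsgn i)
  set V := Matrix.of fun j : Fin (m + 1) => σ.vec j.succ with hV
  set W := Matrix.of fun j : Fin (m + 1) => a j.succ • τ.vec j.succ with hW
  have hrel : ∀ ρ : OrdSimplex (genericComplex K (m + 1)) (m + 1),
      relCoeff ρ.vec 0 = (Matrix.of fun j : Fin (m + 1) => ρ.vec j.succ).det := fun ρ => by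
    simp [relCoeff]
  have hVdet : V.det ≠ 0 := by rw [hV, ← hrel]; exact hlσ 0
  have hWdet : W.det = (∏ j : Fin (m + 1), a j.succ) * relCoeff τ.vec 0 := by
    rw [hrel, hW, det_of_smul]
  set A := (V⁻¹ * W).transpose with hA
  have hAdet : 0 < A.det := by
    -- The coefficients of index 0 are the determinants of the remaining vectors, so their quotient
    -- is `a 0`.
    have : A.det = (∏ j : Fin (m + 1), a j.succ) * a 0 := by
      rw [hA, Matrix.det_transpose, Matrix.det_mul, Matrix.det_nonsing_inv, Ring.inverse_eq_inv',
        hWdet, hV, ← hrel]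
      simp only [ha]
      ring
    rw [this]
    exact mul_pos (Finset.prod_pos fun j _ => hapos _) (hapos 0)
  have hVA : V * A.transpose = W := by
    rw [hA, Matrix.transpose_transpose, ← mul_assoc, Matrix.mul_nonsing_inv _ hVdet.isUnit, one_mul]
  have hsucc : ∀ j : Fin (m + 1), A.mulVec (σ.vec j.succ) = a j.succ • τ.vec j.succ := fun j => by
    have := congrFun hVA j
    ext l
    have := congrFun this l
    rw [Matrix.mul_apply] at this
    simpa [Matrix.mulVec, dotProduct, hV, hW, mul_comm] using this
  have hzero : A.mulVec (σ.vec 0) = a 0 • τ.vec 0 := by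
    have h1 := congrArg A.mulVec (sum_relCoeff_smul σ.vec)
    rw [Matrix.mulVec_sum, Matrix.mulVec_zero, Fin.sum_univ_succ] at h1
    have h2 := sum_relCoeff_smul τ.vec
    rw [Fin.sum_univ_succ] at h2
    simp only [Matrix.mulVec_smul, hsucc, smul_smul, ha, mul_div_cancel₀ _ (hlσ _)] at h1
    have h3 : relCoeff σ.vec 0 • A.mulVec (σ.vec 0) = relCoeff τ.vec 0 • τ.vec 0 :=
      add_right_cancel (h1.trans h2.symm)
    rw [ha]
    simp only
    rw [div_eq_inv_mul, mul_smul, ← h3, smul_smul, inv_mul_cancel₀ (hlσ 0), one_smul]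
  have hall : ∀ i, A.mulVec (σ.vec i) = a i • τ.vec i := fun i => by
    induction i using Fin.cases with
    | zero => exact hzero
    | succ j => exact hsucc j
  let g : Matrix.GLPos (Fin (m + 1)) K :=
    ⟨Matrix.GeneralLinearGroup.mkOfDetNeZero A hAdet.ne', hAdet⟩
  refine ⟨QuotientGroup.mk g, ?_⟩
  ext i
  rw [OrdSimplex.act_apply, mk_smul_ray]
  rw [← (σ.1 i).someVector_ray, ← (τ.1 i).someVector_ray, Module.Ray.map_apply, ray_eq_iff,
    linEquiv_apply]
  change SameRay K (A.mulVec (σ.vec i)) _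
  rw [hall]
  exact SameRay.sameRay_pos_smul_left _ (hapos i)

end Orientation

/-! ### Cones in alternating chains and acyclicity -/

section Cone

variable {V : Type u} {R : Type u} [CommRing R] {X : AbstractSimplicialComplex V} {k : ℕ}

/-- The point `v` can be joined to the simplex `σ`. -/
def Joinable (v : V) (σ : OrdSimplex X k) : Prop :=
  open Classical in insert v (Finset.univ.map σ.1) ∈ X.faces

/-- The simplex `[v, v₀, …, v_k]`. -/
def OrdSimplex.cons (v : V) (σ : OrdSimplex X k) (h : Joinable v σ) (hv : ∀ i, σ.1 i ≠ v) :
    OrdSimplex X (k + 1) :=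
  ⟨⟨Fin.cons v σ.1, Fin.cons_injective_iff.2 ⟨by rintro ⟨i, hi⟩; exact hv i hi, σ.1.injective⟩⟩, by
    classical
    have : Finset.univ.map (⟨Fin.cons v σ.1,
        Fin.cons_injective_iff.2 ⟨by rintro ⟨i, hi⟩; exact hv i hi, σ.1.injective⟩⟩ :
          Fin (k + 1 + 1) ↪ V) = insert v (Finset.univ.map σ.1) := by
      ext x
      simp [Fin.exists_fin_succ, eq_comm]
    rw [this]
    exact h⟩

@[simp]
lemma OrdSimplex.cons_zero (v : V) (σ : OrdSimplex X k) (h : Joinable v σ) (hv : ∀ i, σ.1 i ≠ v) :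
    (σ.cons v h hv).1 0 = v := rfl

@[simp]
lemma OrdSimplex.cons_succ (v : V) (σ : OrdSimplex X k) (h : Joinable v σ) (hv : ∀ i, σ.1 i ≠ v)
    (i : Fin (k + 1)) : (σ.cons v h hv).1 i.succ = σ.1 i := rfl

lemma joinable_perm {v : V} {σ : OrdSimplex X k} {t : Equiv.Perm (Fin (k + 1))} :
    Joinable v (σ.perm t) ↔ Joinable v σ := by
  rw [Joinable, Joinable]
  have : Finset.univ.map (σ.perm t).1 = Finset.univ.map σ.1 := by
    change Finset.univ.map (t.toEmbedding.trans σ.1) = _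
    rw [← Finset.map_map, Finset.map_univ_equiv]
  rw [this]

lemma Joinable.face {v : V} {σ : OrdSimplex X (k + 1)} (h : Joinable v σ) (i : Fin (k + 2)) :
    Joinable v (σ.face i) := by
  classical
  refine (X.isRelLowerSet_faces h).2 ?_ (by simp)
  refine Finset.insert_subset_insert _ ?_
  change Finset.univ.map (i.succAboveEmb.trans σ.1) ⊆ _
  rw [← Finset.map_map]
  exact Finset.map_subset_map.2 (Finset.subset_univ _)

variable (R) in
/-- The cone with apex `v` over a simplex, if it is a simplex of `X`, and `0` otherwise. -/
def coneOf (v : V) (σ : OrdSimplex X k) : Chain R X (k + 1) :=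
  open Classical in
  if h : Joinable v σ ∧ ∀ i, σ.1 i ≠ v then Chain.of R (σ.cons v h.1 h.2) else 0

lemma coneOf_of_mem {v : V} {σ : OrdSimplex X k} {i : Fin (k + 1)} (h : σ.1 i = v) :
    coneOf R v σ = 0 :=
  dif_neg fun h' => h'.2 i h

lemma coneOf_of_joinable {v : V} {σ : OrdSimplex X k} (h : Joinable v σ) (hv : ∀ i, σ.1 i ≠ v) :
    coneOf R v σ = Chain.of R (σ.cons v h hv) :=
  dif_pos ⟨h, hv⟩

/-- Extending `t` by a fixed apex does not change its sign. -/
lemma coneOf_perm (v : V) (σ : OrdSimplex X k) (t : Equiv.Perm (Fin (k + 1))) :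
    coneOf R v (σ.perm t) = (Equiv.Perm.sign t : ℤ) • coneOf R v σ := by
  by_cases h : Joinable v σ ∧ ∀ i, σ.1 i ≠ v
  · rw [coneOf_of_joinable h.1 h.2, coneOf_of_joinable (joinable_perm.2 h.1) fun i => h.2 (t i)]
    have : (σ.perm t).cons v (joinable_perm.2 h.1) (fun i => h.2 (t i)) =
        (σ.cons v h.1 h.2).perm (Equiv.Perm.decomposeFin.symm (0, t)) := by
      ext i
      induction i using Fin.cases <;> simp <;> rfl
    rw [this, Chain.of_perm]
    simp
  · rw [coneOf, coneOf, dif_neg h, dif_neg, smul_zero]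
    rintro ⟨h1, h2⟩
    refine h ⟨joinable_perm.1 h1, fun i => ?_⟩
    simpa using h2 (t.symm i)

variable (R X k) in
/-- The cone operator with apex `v`. -/
def cone (v : V) : Chain R X k →ₗ[R] Chain R X (k + 1) :=
  Chain.lift (coneOf R v) (coneOf_perm v)

@[simp]
lemma cone_of (v : V) (σ : OrdSimplex X k) : cone R X k v (Chain.of R σ) = coneOf R v σ :=
  Chain.lift_of _ _ σ

/-- The contracting homotopy of a cone. If `v` is already a vertex of `σ`, the cone over `σ` is
zero; of the faces, only the one omitting `v` has a nonzero cone, which is `σ` with `v` moved to the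
front by a cycle. -/
lemma boundary_cone_add {v : V} {σ : OrdSimplex X (k + 1)} (h : Joinable v σ) :
    boundary R X (k + 1) (cone R X (k + 1) v (Chain.of R σ)) +
      cone R X k v (boundary R X k (Chain.of R σ)) = Chain.of R σ := by
  simp only [boundary_of, map_sum, map_zsmul, cone_of]
  by_cases hv : ∀ i, σ.1 i ≠ v
  · rw [coneOf_of_joinable h hv, boundary_of, Fin.sum_univ_succ]
    have h0 : (σ.cons v h hv).face 0 = σ := by
      ext i
      simp
    have hs : ∀ i : Fin (k + 2), (σ.cons v h hv).face i.succ =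
        (σ.face i).cons v (h.face i) (fun j => hv (i.succAbove j)) := fun i => by
      ext j
      induction j using Fin.cases <;> simp <;> rfl
    rw [h0]
    simp only [hs, coneOf_of_joinable (h.face _) (fun j => hv (Fin.succAbove _ j)),
      Fin.val_succ, pow_succ, mul_neg, mul_one, neg_smul, Finset.sum_neg_distrib]
    simp
  · push Not at hv
    obtain ⟨i₀, rfl⟩ := hv
    rw [coneOf_of_mem (i := i₀) rfl, map_zero, zero_add, Finset.sum_eq_single i₀]
    · have hne : ∀ j, (σ.face i₀).1 j ≠ σ.1 i₀ := fun j h' =>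
        Fin.succAbove_ne i₀ j (σ.1.injective h')
      rw [coneOf_of_joinable (h.face i₀) hne]
      have : (σ.face i₀).cons (σ.1 i₀) (h.face i₀) hne = σ.perm i₀.cycleRange.symm := by
        ext j
        induction j using Fin.cases <;> simp
      rw [this, Chain.of_perm, Equiv.Perm.sign_symm, Fin.sign_cycleRange, smul_smul]
      push_cast
      rw [← mul_pow]
      simp
    · intro i _ hi
      obtain ⟨j, hj⟩ := Fin.exists_succAbove_eq hi.symm
      rw [coneOf_of_mem (i := j) (by simp [hj]), smul_zero]
    · simp

/-- The `0`-simplex given by a vertex. -/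
def vertexSimplex (X : AbstractSimplicialComplex V) (v : V) : OrdSimplex X 0 :=
  ⟨⟨fun _ => v, fun i j _ => (Fin.eq_zero i).trans (Fin.eq_zero j).symm⟩, by
    have : Finset.univ.map (⟨fun _ => v, fun i j _ => (Fin.eq_zero i).trans (Fin.eq_zero j).symm⟩ :
        Fin (0 + 1) ↪ V) = {v} := rfl
    rw [this]
    exact X.singleton_mem v⟩

lemma boundary_cone_zero {v : V} {σ : OrdSimplex X 0} (h : Joinable v σ) :
    boundary R X 0 (cone R X 0 v (Chain.of R σ)) +
      augmentation R X (Chain.of R σ) • Chain.of R (vertexSimplex X v) = Chain.of R σ := by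
  have haug : augmentation R X (Chain.of R σ) = 1 := by simp [augmentation]
  rw [cone_of, haug, one_smul]
  by_cases hv : σ.1 0 = v
  · rw [coneOf_of_mem hv, map_zero, zero_add]
    congr 1
    ext i
    rw [Fin.eq_zero i, hv]
    rfl
  · have hv' : ∀ i, σ.1 i ≠ v := fun i => by rwa [Fin.eq_zero i]
    have h0 : (σ.cons v h hv').face 0 = σ := by
      ext i
      simp
    have h1 : (σ.cons v h hv').face 1 = vertexSimplex X v := by
      ext i
      rw [Fin.eq_zero i]
      rfl
    rw [coneOf_of_joinable h hv', boundary_of, Fin.sum_univ_two, h0, h1]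
    simp

/-- For each finite set of vertices there is a vertex that can be joined to all simplices spanned
by elements of this set. -/
def HasConePoints (X : AbstractSimplicialComplex V) : Prop :=
  open Classical in
  ∀ S : Finset V, ∃ v, ∀ s ∈ X.faces, s ⊆ S → insert v s ∈ X.faces

/-- Linear maps that agree on the simplices that can be joined to a point agree on a given chain,
for a suitable choice of the point. -/
lemma HasConePoints.exists_eq (hX : HasConePoints X) (z : Chain R X k) :
    ∃ v, ∀ f g : Chain R X k →ₗ[R] Chain R X k,
      (∀ σ, Joinable v σ → f (Chain.of R σ) = g (Chain.of R σ)) → f z = g z := by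
  classical
  -- The apex depends on the chain: it is chosen for the finitely many vertices in the support of a
  -- lift to the free module.
  obtain ⟨x, rfl⟩ := (alternation R X k).mkQ_surjective z
  obtain ⟨v, hv⟩ := hX (x.support.biUnion fun σ => Finset.univ.map σ.1)
  refine ⟨v, fun f g hfg => ?_⟩
  rw [← x.sum_single]
  simp only [Finsupp.sum, map_sum]
  refine Finset.sum_congr rfl fun σ hσ => ?_
  have hσ' : Joinable v σ := by
    rw [Joinable]
    convert hv _ σ.2 (Finset.subset_biUnion_of_mem
      (fun σ : OrdSimplex X k => Finset.univ.map σ.1) hσ)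
  have : (alternation R X k).mkQ (Finsupp.single σ (x σ)) = x σ • Chain.of R σ := by
    rw [Chain.of, ← map_smul, Finsupp.smul_single, smul_eq_mul, mul_one]
  rw [this, map_smul, map_smul, hfg σ hσ']

lemma HasConePoints.exists_boundary_eq (hX : HasConePoints X) (z : Chain R X (k + 1))
    (hz : boundary R X k z = 0) : ∃ y, boundary R X (k + 1) y = z := by
  obtain ⟨v, hv⟩ := hX.exists_eq z
  refine ⟨cone R X (k + 1) v z, ?_⟩
  have := hv (boundary R X (k + 1) ∘ₗ cone R X (k + 1) v + cone R X k v ∘ₗ boundary R X k)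
    LinearMap.id fun σ hσ => boundary_cone_add hσ
  simpa [hz] using this

lemma HasConePoints.exists_boundary_eq_of_augmentation (hX : HasConePoints X) (z : Chain R X 0)
    (hz : augmentation R X z = 0) : ∃ y, boundary R X 0 y = z := by
  obtain ⟨v, hv⟩ := hX.exists_eq z
  refine ⟨cone R X 0 v z, ?_⟩
  have := hv (boundary R X 0 ∘ₗ cone R X 0 v +
    (augmentation R X).smulRight (Chain.of R (vertexSimplex X v))) LinearMap.id
    fun σ hσ => boundary_cone_zero hσ
  simpa [hz] using this

lemma HasConePoints.augmentation_surjective (hX : HasConePoints X) :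
    Function.Surjective (augmentation R X) := fun r => by
  obtain ⟨v, -⟩ := hX ∅
  refine ⟨r • Chain.of R (vertexSimplex X v), ?_⟩
  simp [augmentation]

end Cone

/-! ### Generic points of positive projective space -/

section GenericPoints

variable {K : Type u} [Field K] [LinearOrder K] [IsStrictOrderedRing K] {n : ℕ}

/-- Fewer than `n` vectors span a proper subspace, and over an infinite field finitely many proper
subspaces do not cover Kⁿ. -/
lemma exists_notMem_span (S : Finset (PosProj K n)) :
    ∃ v : Fin n → K, ∀ t ⊆ S, t.card < n →
      v ∉ Submodule.span K ((fun p : PosProj K n => p.someVector) '' (t : Set (PosProj K n))) := by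
  classical
  set T : Finset (Submodule K (Fin n → K)) := (S.powerset.filter fun t => t.card < n).image
    fun t : Finset (PosProj K n) =>
      Submodule.span K ((fun p : PosProj K n => p.someVector) '' (t : Set (PosProj K n))) with hT
  have htop : ⊤ ∉ T := by
    intro h
    obtain ⟨t, ht, htop⟩ := Finset.mem_image.1 h
    have ht' := (Finset.mem_filter.1 ht).2
    have h1 := finrank_span_finset_le_card (R := K) (t.image fun p : PosProj K n => p.someVector)
    rw [Finset.coe_image, Set.finrank, htop, finrank_top, Module.finrank_fin_fun] at h1
    exact absurd (h1.trans Finset.card_image_le) (by omega)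
  have := Subspace.biUnion_ne_univ_of_top_notMem htop
  rw [Set.ne_univ_iff_exists_notMem] at this
  obtain ⟨v, hv⟩ := this
  refine ⟨v, fun t ht htn hvt => hv ?_⟩
  simp only [Set.mem_iUnion]
  exact ⟨_, Finset.mem_image.2 ⟨t, by simp [ht, htn], rfl⟩, hvt⟩

/-- A point of `P₊ⁿ⁻¹(K)` that is generic with respect to a finite set. -/
lemma exists_generic_point (hn : 1 ≤ n) (S : Finset (PosProj K n)) :
    ∃ p : PosProj K n, ∀ t ⊆ S, t.card < n → p.someVector ∉
      Submodule.span K ((fun p : PosProj K n => p.someVector) '' (t : Set (PosProj K n))) := by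
  obtain ⟨v, hv⟩ := exists_notMem_span S
  have hv0 : v ≠ 0 := by
    rintro rfl
    exact hv ∅ (Finset.empty_subset _) hn (Submodule.zero_mem _)
  refine ⟨rayOfNeZero K v hv0, fun t ht htn hmem => hv t ht htn ?_⟩
  obtain ⟨c, hc, hcv⟩ := exists_pos_smul_eq_someVector _ hv0 rfl
  rw [hcv] at hmem
  exact (Submodule.smul_mem_iff _ hc.ne').1 hmem

lemma insert_mem_genericComplex [DecidableEq (PosProj K n)] {S : Finset (PosProj K n)}
    {p : PosProj K n} (hp : ∀ t ⊆ S, t.card < n → p.someVector ∉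
      Submodule.span K ((fun p : PosProj K n => p.someVector) '' (t : Set (PosProj K n))))
    {s : Finset (PosProj K n)} (hs : s ∈ (genericComplex K n).faces) (hsS : s ⊆ S) :
    insert p s ∈ (genericComplex K n).faces := by
  refine ⟨Finset.insert_nonempty _ _, fun t ht htn => ?_⟩
  by_cases hpt : p ∈ t
  · have hes : t.erase p ⊆ s := Finset.subset_insert_iff.1 ht
    have hcard : (t.erase p).card < n := by
      have := Finset.card_erase_add_one hpt
      omega
    rw [← Finset.insert_erase hpt, Finset.coe_insert]
    exact (hs.2 _ hes hcard.le).insert (hp _ (hes.trans hsS) hcard)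
  · exact hs.2 t (fun x hx => (Finset.mem_insert.1 (ht hx)).resolve_left
      fun h => hpt (h ▸ hx)) htn

lemma hasConePoints_genericComplex (hn : 1 ≤ n) : HasConePoints (genericComplex K n) := fun S => by
  classical
  obtain ⟨p, hp⟩ := exists_generic_point hn S
  exact ⟨p, fun s hs hsS => insert_mem_genericComplex hp hs hsS⟩

/-- For `n ≥ 2`, each simplex of `X₊` is a face of a simplex of the next dimension. -/
lemma exists_ordSimplex_succ (hn : 2 ≤ n) {k : ℕ} (σ : OrdSimplex (genericComplex K n) k) :
    Nonempty (OrdSimplex (genericComplex K n) (k + 1)) := by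
  classical
  obtain ⟨p, hp⟩ := exists_generic_point (by omega) (Finset.univ.map σ.1)
  refine ⟨σ.cons p ?_ fun i hi => ?_⟩
  · rw [Joinable]
    convert insert_mem_genericComplex hp σ.2 subset_rfl
  -- Since n ≥ 2, genericity applies to single vertices, so `p` is a new vertex.
  · refine hp {σ.1 i} (by simp) (by rw [Finset.card_singleton]; omega) ?_
    rw [← hi]
    exact Submodule.subset_span (by simp)

end GenericPoints

/-! ### Existence of chain maps from the bar resolution -/

section Resolution

variable {R G : Type u} [CommRing R] [Group G]

lemma exact_of_forall_exists (S : ShortComplex (Rep.{u} R G))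
    (h : ∀ x : S.X₂, S.g.hom x = 0 → ∃ y : S.X₁, S.f.hom y = x) : S.Exact := by
  rw [← ShortComplex.exact_map_iff_of_faithful S (forget₂ (Rep.{u} R G) (ModuleCat.{u} R)),
    ShortComplex.moduleCat_exact_iff]
  exact h

/-- The identity of the trivial module lifts to a chain map from a projective resolution to any
complex that is a resolution. -/
lemma exists_lift (P : ProjectiveResolution (Rep.trivial R G R)) {C : ChainComplex (Rep.{u} R G) ℕ}
    (π : C ⟶ (ChainComplex.single₀ (Rep.{u} R G)).obj (Rep.trivial R G R))
    (hepi : Epi (π.f 0))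
    (h0 : (ShortComplex.mk (C.d 1 0) (π.f 0) (by rw [← π.comm 1 0]; exact Limits.comp_zero)).Exact)
    (hs : ∀ n, (ShortComplex.mk (C.d (n + 2) (n + 1)) (C.d (n + 1) n) (by simp)).Exact) :
    ∃ ψ : P.complex ⟶ C, ψ ≫ π = P.π := by
  set f0 : P.complex.X 0 ⟶ C.X 0 := Projective.factorThru (P.π.f 0) (π.f 0) with hf0
  have hf0π : f0 ≫ π.f 0 = P.π.f 0 := Projective.factorThru_comp _ _
  have w0 : (P.complex.d 1 0 ≫ f0) ≫ π.f 0 = 0 := by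
    rw [Category.assoc, hf0π]
    exact P.complex_d_comp_π_f_zero
  set f1 : P.complex.X 1 ⟶ C.X 1 := h0.liftFromProjective (P.complex.d 1 0 ≫ f0) w0
  have hf1 : f1 ≫ C.d 1 0 = P.complex.d 1 0 ≫ f0 := h0.liftFromProjective_comp _ _
  refine ⟨ChainComplex.mkHom _ _ f0 f1 hf1 fun n p =>
    ⟨(hs n).liftFromProjective (P.complex.d (n + 2) (n + 1) ≫ p.2.1) (by simp [p.2.2]),
      (hs n).liftFromProjective_comp _ _⟩, ?_⟩
  apply HomologicalComplex.to_single_hom_ext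
  rw [HomologicalComplex.comp_f, ChainComplex.mkHom_f_0, hf0π]

variable {V : Type u} {X : AbstractSimplicialComplex V} [MulAction G V] [SimplicialAction G X]

lemma augmentationMap_f_zero_apply (z : Chain R X 0) :
    ((augmentationMap R X G).f 0).hom z = augmentation R X z := by
  have h := ChainComplex.toSingle₀Equiv_symm_apply_f_zero (C := chainComplex R X G)
    (((chainComplex R X G).toSingle₀Equiv (Rep.trivial R G R)) (augmentationMap R X G)).1
    (((chainComplex R X G).toSingle₀Equiv (Rep.trivial R G R)) (augmentationMap R X G)).2
  rw [Subtype.coe_eta, Equiv.symm_apply_apply] at h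
  rw [h, augmentationMap, Equiv.apply_symm_apply]
  rfl

/-- Cones make the augmented simplicial complex exact, so the comparison theorem for projective
resolutions applies. -/
lemma exists_resolutionMap (hX : HasConePoints X) :
    ∃ ψ : Rep.barComplex R G ⟶ chainComplex R X G,
      ψ ≫ augmentationMap R X G = (Rep.barResolution R G).π := by
  refine exists_lift (Rep.barResolution R G) (augmentationMap R X G) ?_ ?_ fun n => ?_
  · rw [Rep.epi_iff_surjective]
    intro r
    obtain ⟨z, hz⟩ := hX.augmentation_surjective (R := R) r
    exact ⟨z, (augmentationMap_f_zero_apply z).trans hz⟩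
  · refine exact_of_forall_exists _ fun z hz => ?_
    obtain ⟨y, hy⟩ := hX.exists_boundary_eq_of_augmentation z
      ((augmentationMap_f_zero_apply z).symm.trans hz)
    refine ⟨y, ?_⟩
    simp only [chainComplex_d]
    exact hy
  · refine exact_of_forall_exists _ fun z hz => ?_
    simp only [chainComplex_d] at hz ⊢
    exact hX.exists_boundary_eq z hz

end Resolution

/-! ### From relations between cocycles to relations between classes -/

section Cohomology

variable {R G : Type u} [CommRing R] [Group G] {C : ChainComplex (Rep.{u} R G) ℕ}

/-- A map of coefficients `A ⟶ B` induces a cochain map `Hom_G(C, A) ⟶ Hom_G(C, B)`. -/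
def homPush (C : ChainComplex (Rep.{u} R G) ℕ) {A B : Rep.{u} R G} (f : A ⟶ B) :
    C.linearYonedaObj R A ⟶ C.linearYonedaObj R B where
  f i := ModuleCat.ofHom (Linear.rightComp R (C.X i) f)
  comm' i j _ := by
    rw [ChainComplex.linearYonedaObj_d, ChainComplex.linearYonedaObj_d]
    refine ModuleCat.hom_ext (LinearMap.ext fun (T : C.X i ⟶ A) => ?_)
    change C.d j i ≫ T ≫ f = (C.d j i ≫ T) ≫ f
    rw [Category.assoc]

lemma homPullback_comp_cochainsMap (ψ : Rep.barComplex R G ⟶ C) {A B : Rep.{u} R G} (f : A ⟶ B) :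
    (homPullback ψ A ≫ (groupCohomology.inhomogeneousCochainsIso A).inv) ≫
        groupCohomology.cochainsMap (MonoidHom.id G) f =
      homPush C f ≫ homPullback ψ B ≫ (groupCohomology.inhomogeneousCochainsIso B).inv := by
  rfl

lemma cycles_ext {K : CochainComplex (ModuleCat.{u} R) ℕ} {d : ℕ} {x y : K.cycles d}
    (h : K.iCycles d x = K.iCycles d y) : x = y :=
  (ModuleCat.mono_iff_injective (K.iCycles d)).1 inferInstance h

lemma iCycles_homCocycle (C : ChainComplex (Rep.{u} R G) ℕ) (A : Rep.{u} R G) (d : ℕ)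
    (T : C.X d ⟶ A) (hT : C.d (d + 1) d ≫ T = 0) :
    (C.linearYonedaObj R A).iCycles d
      ((C.linearYonedaObj R A).cyclesMk T (d + 1) (by simp) hT) = T :=
  (C.linearYonedaObj R A).i_cyclesMk T (d + 1) (by simp) hT

lemma homologyMap_homClass {A B : Rep.{u} R G} (f : A ⟶ B) (d : ℕ)
    (T : C.X d ⟶ A) (hT : C.d (d + 1) d ≫ T = 0) :
    HomologicalComplex.homologyMap (homPush C f) d (homClass C A d T hT) =
      homClass C B d (T ≫ f) (by rw [← Category.assoc, hT, Limits.zero_comp]) := by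
  rw [homClass, homClass, ← ConcreteCategory.comp_apply, HomologicalComplex.homologyπ_naturality,
    ConcreteCategory.comp_apply]
  congr 1
  apply cycles_ext
  rw [iCycles_homCocycle, ← ConcreteCategory.comp_apply, HomologicalComplex.cyclesMap_i,
    ConcreteCategory.comp_apply, iCycles_homCocycle]
  rfl

lemma homClass_sum {ι : Type*} (s : Finset ι) (A : Rep.{u} R G) (d : ℕ) (a : ι → ℤ)
    (T : ι → (C.X d ⟶ A)) (hT : ∀ i, C.d (d + 1) d ≫ T i = 0) :
    ∑ i ∈ s, a i • homClass C A d (T i) (hT i) =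
      homClass C A d (∑ i ∈ s, a i • T i)
        (by rw [Preadditive.comp_sum]; simp [hT]) := by
  simp only [homClass]
  rw [← Finset.sum_congr rfl fun i _ => map_zsmul _ (a i) _, ← map_sum]
  congr 1
  apply cycles_ext
  rw [iCycles_homCocycle, map_sum]
  refine Finset.sum_congr rfl fun i _ => ?_
  rw [map_zsmul, iCycles_homCocycle]
  rfl

lemma homClass_coboundary (A : Rep.{u} R G) (d : ℕ) (c : C.X d ⟶ A) :
    homClass C A (d + 1) (C.d (d + 1) d ≫ c) (by rw [← Category.assoc]; simp) = 0 := by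
  have h : (C.linearYonedaObj R A).cyclesMk (C.d (d + 1) d ≫ c) (d + 1 + 1) (by simp)
      (by change C.d _ _ ≫ C.d _ _ ≫ c = 0; rw [← Category.assoc]; simp) =
      (C.linearYonedaObj R A).toCycles d (d + 1) c := by
    apply cycles_ext
    refine (iCycles_homCocycle C A (d + 1) _ _).trans ?_
    exact (ConcreteCategory.congr_hom
      ((C.linearYonedaObj R A).toCycles_i d (d + 1)) c).symm
  exact (congrArg ((C.linearYonedaObj R A).homologyπ (d + 1)) h).trans
    (ConcreteCategory.congr_hom ((C.linearYonedaObj R A).toCycles_comp_homologyπ d (d + 1)) c)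

/-- Pulling back along ψ is precomposition and changing coefficients is postcomposition, so they
commute. A component of the class can thus be computed from the component of the cocycle. -/
lemma coeffMap_tautClass (ψ : Rep.barComplex R G ⟶ C) (d : ℕ) {N : Type u} [AddCommGroup N]
    [Module R N] (p : coeffGroup C d →ₗ[R] N) :
    coeffMap p d (tautClass ψ d) =
      pullbackClass ψ (Rep.trivial R G N) d
        (homClass C _ d (tautCocycle C d ≫ trivialMap p)
          (by rw [← Category.assoc, d_comp_tautCocycle, Limits.zero_comp])) := by
  have h := congrArg (fun F => HomologicalComplex.homologyMap F d)
    (homPullback_comp_cochainsMap ψ (trivialMap (G := G) p))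
  simp only [HomologicalComplex.homologyMap_comp _ (groupCohomology.cochainsMap _ _),
    HomologicalComplex.homologyMap_comp (homPush _ _) _] at h
  rw [← homologyMap_homClass (trivialMap p) d (tautCocycle C d) (d_comp_tautCocycle C d)]
  exact ConcreteCategory.congr_hom h _

/-- A relation between components of the tautological cocycle that holds up to a coboundary gives
a relation between the components of the tautological class. -/
lemma sum_coeffMap_tautClass_eq_zero (ψ : Rep.barComplex R G ⟶ C) (d : ℕ) {N : Type u}
    [AddCommGroup N] [Module R N] {ι : Type*} [Fintype ι] (a : ι → ℤ)
    (p : ι → (coeffGroup C (d + 1) →ₗ[R] N)) (c : C.X d ⟶ Rep.trivial R G N)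
    (h : C.d (d + 1) d ≫ c = ∑ i, a i • (tautCocycle C (d + 1) ≫ trivialMap (p i))) :
    ∑ i, a i • coeffMap (p i) (d + 1) (tautClass ψ (d + 1)) = 0 := by
  simp only [coeffMap_tautClass]
  rw [← Finset.sum_congr rfl fun i _ => map_zsmul _ (a i) _, ← map_sum, homClass_sum]
  simp only [← h]
  rw [homClass_coboundary, map_zero]

end Cohomology

/-! ### Generators and relations of the coefficient group -/

section CoeffGroup

variable {R G V : Type u} [CommRing R] [Group G] {X : AbstractSimplicialComplex V}
  [MulAction G V] [SimplicialAction G X] {k : ℕ}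

variable (R G) in
/-- The value of the tautological cocycle on an ordered simplex. -/
def tautValue (σ : OrdSimplex X k) : coeffGroup (chainComplex R X G) k :=
  (tautCocycle (chainComplex R X G) k).hom (simplexChain R G σ)

lemma tautValue_perm (σ : OrdSimplex X k) (t : Equiv.Perm (Fin (k + 1))) :
    tautValue R G (σ.perm t) = (Equiv.Perm.sign t : ℤ) • tautValue R G σ := by
  change (tautCocycle (chainComplex R X G) k).hom (Chain.of R (σ.perm t)) = _
  rw [Chain.of_perm]
  exact map_zsmul (tautCocycle (chainComplex R X G) k).hom _ _

lemma tautValue_act (g : G) (σ : OrdSimplex X k) :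
    tautValue R G (σ.act g) = tautValue R G σ := by
  have h := Rep.hom_comm_apply (tautCocycle (chainComplex R X G) k) g (simplexChain R G σ)
  have h' : ((chainComplex R X G).X k).ρ g (simplexChain R G σ) = simplexChain R G (σ.act g) :=
    chainRep_of g σ
  rw [h'] at h
  exact h

lemma sum_tautValue_face (ρ : OrdSimplex X (k + 1)) :
    ∑ i : Fin (k + 2), (-1 : ℤ) ^ (i : ℕ) • tautValue R G (ρ.face i) = 0 := by
  have h1 := congrArg (fun f => f.hom (simplexChain R G ρ))
    (d_comp_tautCocycle (chainComplex R X G) k)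
  rw [chainComplex_d] at h1
  have h2 : (tautCocycle (chainComplex R X G) k).hom (boundary R X k (Chain.of R ρ)) = 0 := h1
  rw [boundary_of] at h2
  rw [← h2]
  refine Eq.trans ?_ (map_sum (tautCocycle (chainComplex R X G) k).hom _ _).symm
  refine Finset.sum_congr rfl fun i _ => ?_
  exact (map_zsmul (tautCocycle (chainComplex R X G) k).hom _ _).symm

/-- The values of simplices generate the coefficient group, a quotient of the chains. -/
lemma coeffGroup_hom_ext {M : Type*} [AddCommGroup M] [Module R M]
    {f g : coeffGroup (chainComplex R X G) k →ₗ[R] M}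
    (h : ∀ σ, f (tautValue R G σ) = g (tautValue R G σ)) : f = g := by
  apply Representation.Coinvariants.hom_ext
  apply Submodule.linearMap_qext
  exact Chain.hom_ext (X := X) h

lemma boundaries_chainComplex :
    boundaries (chainComplex R X G) k = LinearMap.range (boundary R X k) := by
  rw [boundaries, chainComplex_d]
  rfl

/-- An alternating invariant function on ordered simplices that vanishes on boundaries extends to
the coefficient group. -/
lemma exists_coeffGroup_lift {M : Type*} [AddCommGroup M] [Module R M] (f : OrdSimplex X k → M)
    (hf : ∀ σ t, f (σ.perm t) = (Equiv.Perm.sign t : ℤ) • f σ)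
    (hg : ∀ (g : G) σ, f (σ.act g) = f σ)
    (hb : ∀ ρ : OrdSimplex X (k + 1), ∑ i : Fin (k + 2), (-1 : ℤ) ^ (i : ℕ) • f (ρ.face i) = 0) :
    ∃ F : coeffGroup (chainComplex R X G) k →ₗ[R] M, ∀ σ, F (tautValue R G σ) = f σ := by
  have hle : boundaries (chainComplex R X G) k ≤ LinearMap.ker (Chain.lift (R := R) f hf) := by
    refine (le_of_eq boundaries_chainComplex).trans (LinearMap.range_le_ker_iff.2 ?_)
    refine Chain.hom_ext fun ρ => ?_
    simp [map_sum, hb]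
  refine ⟨Representation.Coinvariants.lift _ ((boundaries (chainComplex R X G) k).liftQ
    (Chain.lift (R := R) f hf) hle) fun g => ?_, fun σ => ?_⟩
  · apply Submodule.linearMap_qext
    refine Chain.hom_ext (X := X) fun σ => ?_
    change Chain.lift (R := R) f hf (chainRep R X k G g (Chain.of R σ)) =
      Chain.lift (R := R) f hf (Chain.of R σ)
    rw [chainRep_of, Chain.lift_of, Chain.lift_of, hg]
  · exact Chain.lift_of f hf σ

end CoeffGroup

/-! ### The structure of U₊ -/

section Signs

set_option linter.unusedSectionVars false

variable {K : Type u} [Field K] [LinearOrder K] [IsStrictOrderedRing K] {m : ℕ}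

/-- The number of vertices with a given sign. -/
def signCount (σ : OrdSimplex (genericComplex K (m + 1)) (m + 1)) (s : ℤ) : ℕ :=
  (Finset.univ.filter fun i => vertexSign σ i = s).card

lemma signCount_perm_mul (σ : OrdSimplex (genericComplex K (m + 1)) (m + 1))
    (t : Equiv.Perm (Fin (m + 2))) (s : ℤ) :
    signCount (σ.perm t) (Equiv.Perm.sign t * s) = signCount σ s := by
  rw [signCount, signCount]
  refine Finset.card_bij (fun i _ => t i) (fun i hi => ?_) (by simp) fun i hi => ?_
  · simpa [vertexSign_perm] using hi
  · exact ⟨t.symm i, by simpa [vertexSign_perm] using hi, by simp⟩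

lemma signCount_act (g : PGLPos K (m + 1)) (σ : OrdSimplex (genericComplex K (m + 1)) (m + 1))
    (s : ℤ) : signCount (σ.act g) s = signCount σ s := by
  simp only [signCount, vertexSign_act]

lemma signCount_add (σ : OrdSimplex (genericComplex K (m + 1)) (m + 1)) :
    signCount σ 1 + signCount σ (-1) = m + 2 := by
  have h : (Finset.univ.filter fun i => vertexSign σ i = -1) =
      Finset.univ.filter fun i => ¬ vertexSign σ i = 1 := by
    ext i
    rcases vertexSign_eq_one_or σ i with h | h <;> simp [h]
  rw [signCount, signCount, h, Finset.card_filter_add_card_filter_not]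
  simp

lemma sum_vertexSign (σ : OrdSimplex (genericComplex K (m + 1)) (m + 1)) :
    ∑ i, vertexSign σ i = signCount σ 1 - signCount σ (-1) := by
  rw [signCount, signCount, Finset.card_filter, Finset.card_filter]
  push_cast
  rw [← Finset.sum_sub_distrib]
  refine Finset.sum_congr rfl fun i _ => ?_
  rcases vertexSign_eq_one_or σ i with h | h <;> simp [h]

/-- Two vertices of an `n`-simplex of `X₊` have the same sign. -/
lemma exists_vertexSign_eq (σ : OrdSimplex (genericComplex K (m + 1)) (m + 1)) :
    ∃ i j, i ≠ j ∧ vertexSign σ i = vertexSign σ j := by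
  rcases m with _ | m
  -- For n = 1, opposite signs would make one vector a positive multiple of the other, contradicting
  -- the distinctness of the vertices. For n ≥ 2 there are at least three vertices and two signs.
  · refine ⟨0, 1, by simp, ?_⟩
    by_contra hne
    have hrel := sum_relCoeff_smul σ.vec
    have h0 := relCoeff_vec_ne_zero σ 0
    have h1 := relCoeff_vec_ne_zero σ 1
    have hpos : 0 < - relCoeff σ.vec 1 / relCoeff σ.vec 0 := by
      rw [vertexSign_eq_sign, vertexSign_eq_sign] at hne
      rcases lt_or_gt_of_ne h0 with h0 | h0 <;> rcases lt_or_gt_of_ne h1 with h1 | h1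
      · simp [sign_neg h0, sign_neg h1] at hne
      · exact div_pos_of_neg_of_neg (neg_neg_iff_pos.2 h1) h0
      · exact div_pos (neg_pos.2 h1) h0
      · simp [sign_pos h0, sign_pos h1] at hne
    rw [Fin.sum_univ_two] at hrel
    have hv : σ.vec 0 = (- relCoeff σ.vec 1 / relCoeff σ.vec 0) • σ.vec 1 := by
      rw [div_eq_inv_mul, mul_smul, neg_smul, ← eq_neg_of_add_eq_zero_left hrel, smul_smul,
        inv_mul_cancel₀ h0, one_smul]
    have hray : SameRay K (σ.vec 0) (σ.vec 1) := by
      rw [hv]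
      exact SameRay.sameRay_pos_smul_left _ hpos
    have : σ.1 0 = σ.1 1 := by
      rw [← (σ.1 0).someVector_ray, ← (σ.1 1).someVector_ray]
      exact (ray_eq_iff _ _).2 hray
    exact absurd (σ.1.injective this) (by simp)
  · obtain ⟨i, j, hij, h⟩ := Fintype.exists_ne_map_eq_of_card_lt
      (fun i => decide (vertexSign σ i = 1)) (by simp)
    refine ⟨i, j, hij, ?_⟩
    simp only [decide_eq_decide] at h
    rcases vertexSign_eq_one_or σ i with h1 | h1 <;> rcases vertexSign_eq_one_or σ j with h2 | h2 <;>
      simp_all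

/-- Sign vectors with equally many signs of each kind differ by a permutation of any given sign. -/
lemma exists_perm_vertexSign {σ τ : OrdSimplex (genericComplex K (m + 1)) (m + 1)} {s s' : ℤ}
    (hs : s = 1 ∨ s = -1) (hs' : s' = 1 ∨ s' = -1) (h : signCount σ s = signCount τ s') (ε : ℤˣ) :
    ∃ t : Equiv.Perm (Fin (m + 2)), Equiv.Perm.sign t = ε ∧
      ∀ i, vertexSign σ (t i) = s * s' * vertexSign τ i := by
  have hex : ∃ t : Equiv.Perm (Fin (m + 2)), ∀ i, vertexSign σ (t i) = s * s' * vertexSign τ i := by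
    have e : {i // vertexSign τ i = s'} ≃ {i // vertexSign σ i = s} := Fintype.equivOfCardEq (by
      rw [Fintype.card_subtype, Fintype.card_subtype]
      exact h.symm)
    refine ⟨e.extendSubtype, fun i => ?_⟩
    by_cases hi : vertexSign τ i = s'
    · rw [e.extendSubtype_mem i hi, hi]
      rcases hs' with rfl | rfl <;> simp
    · have h1 := e.extendSubtype_not_mem i hi
      rcases vertexSign_eq_one_or σ (e.extendSubtype i) with h2 | h2 <;>
        rcases vertexSign_eq_one_or τ i with h3 | h3 <;> rcases hs with rfl | rfl <;>
        rcases hs' with rfl | rfl <;> simp_all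
  obtain ⟨t, ht⟩ := hex
  by_cases hε : Equiv.Perm.sign t = ε
  · exact ⟨t, hε, ht⟩
  -- Composing with the transposition of two vertices of equal sign corrects the parity and leaves
  -- the sign vector unchanged.
  · obtain ⟨i, j, hij, hsgn⟩ := exists_vertexSign_eq σ
    refine ⟨Equiv.swap i j * t, ?_, fun l => ?_⟩
    · rw [Equiv.Perm.sign_mul, Equiv.Perm.sign_swap hij]
      rcases Int.units_eq_one_or (Equiv.Perm.sign t) with h1 | h1 <;>
        rcases Int.units_eq_one_or ε with h2 | h2 <;> simp_all
    · rw [← ht l, Equiv.Perm.mul_apply, Equiv.swap_apply_def]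
      split_ifs with h1 h2
      · rw [h1, hsgn]
      · rw [h2, hsgn]
      · rfl

/-- The value in `U₊` of an ordered `n`-simplex of `X₊`. -/
abbrev plusValue (σ : OrdSimplex (genericComplex K (m + 1)) (m + 1)) : UPlus K (m + 1) :=
  tautValue ZZ.{u} (PGLPos K (m + 1)) σ

lemma plusValue_eq {σ τ : OrdSimplex (genericComplex K (m + 1)) (m + 1)} {s : ℤ}
    (hs : s = 1 ∨ s = -1) (h : signCount σ s = signCount τ s) : plusValue σ = plusValue τ := by
  obtain ⟨t, ht, hsgn⟩ := exists_perm_vertexSign hs hs h 1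
  obtain ⟨g, hg⟩ := exists_act_eq (σ := σ.perm t) (τ := τ) fun i => by
    rw [vertexSign_perm, hsgn, ht]
    rcases hs with rfl | rfl <;> simp
  rw [plusValue, plusValue, ← hg, tautValue_act, tautValue_perm, ht]
  simp

/-- An odd reordering flips all vertex signs. Choosing one that carries the sign vector of `σ` to
that of `τ` puts the reordered `σ` in the orbit of `τ`, at the cost of a factor -1. -/
lemma plusValue_eq_neg {σ τ : OrdSimplex (genericComplex K (m + 1)) (m + 1)} {s : ℤ}
    (hs : s = 1 ∨ s = -1) (h : signCount σ s = signCount τ (-s)) :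
    plusValue σ = - plusValue τ := by
  have hs' : -s = 1 ∨ -s = -1 := by rcases hs with rfl | rfl <;> simp
  obtain ⟨t, ht, hsgn⟩ := exists_perm_vertexSign hs hs' h (-1)
  obtain ⟨g, hg⟩ := exists_act_eq (σ := σ.perm t) (τ := τ) fun i => by
    rw [vertexSign_perm, hsgn, ht]
    rcases hs with rfl | rfl <;> simp
  rw [plusValue, plusValue, ← hg, tautValue_act, tautValue_perm, ht]
  simp

/-- The minority type of the simplex: the signed indicator of the numbers of vertices of sign
`-(-1)ⁿ` and `(-1)ⁿ`. -/
def typeIndicator (σ : OrdSimplex (genericComplex K (m + 1)) (m + 1)) (a : ℕ) : ℤ :=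
  (if signCount σ (-(-1) ^ (m + 1)) = a then 1 else 0) -
    if signCount σ ((-1) ^ (m + 1)) = a then 1 else 0

lemma typeIndicator_perm (σ : OrdSimplex (genericComplex K (m + 1)) (m + 1))
    (t : Equiv.Perm (Fin (m + 2))) (a : ℕ) :
    typeIndicator (σ.perm t) a = Equiv.Perm.sign t * typeIndicator σ a := by
  have h1 := signCount_perm_mul σ t ((-1) ^ (m + 1))
  have h2 := signCount_perm_mul σ t (-(-1) ^ (m + 1))
  rw [typeIndicator, typeIndicator]
  rcases Int.units_eq_one_or (Equiv.Perm.sign t) with ht | ht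
  · simp only [ht, Units.val_one, one_mul] at h1 h2 ⊢
    rw [h1, h2]
  · simp only [ht, Units.val_neg, Units.val_one, neg_mul, one_mul, neg_neg] at h1 h2 ⊢
    rw [h1, h2]
    ring

lemma typeIndicator_act (g : PGLPos K (m + 1))
    (σ : OrdSimplex (genericComplex K (m + 1)) (m + 1)) (a : ℕ) :
    typeIndicator (σ.act g) a = typeIndicator σ a := by
  simp only [typeIndicator, signCount_act]

lemma isPlanar_galeArea_vec (ρ : OrdSimplex (genericComplex K (m + 1)) (m + 2)) :
    IsPlanar (galeArea ρ.vec) :=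
  isPlanar_galeArea fun j i => relCoeff_vec_ne_zero (ρ.face j) i

lemma coe_sign_eq_iff (x : K) (s : SignType) : ((SignType.sign x : SignType) : ℤ) = s ↔
    SignType.sign x = s := by
  generalize SignType.sign x = s'
  revert s s'
  decide

/-- Row `j` of `galeArea` is (-1)^j times the relation of the j-th face. -/
lemma counts_galeArea (ρ : OrdSimplex (genericComplex K (m + 1)) (m + 2)) (j : Fin (m + 3)) :
    negCount (galeArea ρ.vec) j = signCount (ρ.face j) (-(-1) ^ (j : ℕ)) ∧
      posCount (galeArea ρ.vec) j = signCount (ρ.face j) ((-1) ^ (j : ℕ)) := by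
  have hcard : ∀ (P : Fin (m + 3) → Prop) [DecidablePred P], ¬ P j →
      (Finset.univ.filter P).card = (Finset.univ.filter fun i => P (j.succAbove i)).card :=
    fun P _ hP => by
      refine (Finset.card_bij (fun i _ => j.succAbove i) (by simp) (by simp) fun i hi => ?_).symm
      have hij : i ≠ j := by
        rintro rfl
        exact hP (by simpa using hi)
      obtain ⟨i, rfl⟩ := Fin.exists_succAbove_eq hij
      exact ⟨i, by simpa using hi, rfl⟩
  have hneg : ∀ x : K, ((SignType.sign x : SignType) : ℤ) = -1 ↔ x < 0 := fun x => by
    rw [← sign_eq_neg_one_iff, ← coe_sign_eq_iff]; rfl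
  have hpos : ∀ x : K, ((SignType.sign x : SignType) : ℤ) = 1 ↔ 0 < x := fun x => by
    rw [← sign_eq_one_iff, ← coe_sign_eq_iff]; rfl
  have hface : (ρ.face j).vec = fun l => ρ.vec (j.succAbove l) := rfl
  rw [negCount, posCount, hcard (fun i => galeArea ρ.vec j i < 0) (by simp),
    hcard (fun i => 0 < galeArea ρ.vec j i) (by simp)]
  simp only [galeArea_succAbove, signCount, vertexSign_eq_sign, hface]
  rcases Nat.even_or_odd (j : ℕ) with h | h
  · simp [h.neg_one_pow, hneg, hpos]
  · simp [h.neg_one_pow, hneg, hpos]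

/-- The sign (-1)^j of the boundary compensates the exchange of the counts in `counts_galeArea`.
What remains is `IsPlanar.sum_sub_eq_zero` for the indicator function of `a`. -/
lemma sum_typeIndicator_face (ρ : OrdSimplex (genericComplex K (m + 1)) (m + 2)) (a : ℕ) :
    ∑ j : Fin (m + 3), (-1 : ℤ) ^ (j : ℕ) * typeIndicator (ρ.face j) a = 0 := by
  have h := (isPlanar_galeArea_vec ρ).sum_sub_eq_zero (by omega) fun c => if c = a then 1 else 0
  simp only [counts_galeArea] at h
  rw [← mul_zero ((-1 : ℤ) ^ (m + 1)), ← h, Finset.mul_sum]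
  refine Finset.sum_congr rfl fun j _ => ?_
  rw [typeIndicator]
  rcases neg_one_pow_eq_or ℤ (m + 1) with h1 | h1 <;>
    rcases neg_one_pow_eq_or ℤ (j : ℕ) with h2 | h2 <;> rw [h1, h2] <;> simp

/-- The last vector has coefficient (-1)ⁿ, and the coordinates of the relation then determine the
others. This explains the choice of signs in `typeIndicator`. -/
lemma vertexSign_symbolSimplex (hn : 1 ≤ m + 1) (a : Fin ((m + 1) / 2 + 1)) (i : Fin (m + 2)) :
    vertexSign (symbolSimplex K hn a) i = -(-1) ^ (m + 1) ↔ (i : ℕ) < a := by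
  have hrep := vertexSign_eq_sign_of_rep (symbolSimplex K hn a) (symbolVec K (m + 1) a)
    (symbolVec_ne_zero K hn a) fun _ => rfl
  have hlast : relCoeff (symbolVec K (m + 1) a) (Fin.last (m + 1)) = (-1) ^ (m + 1) := by
    have : (Matrix.of fun j => symbolVec K (m + 1) a ((Fin.last (m + 1)).succAbove j)) =
        (1 : Matrix (Fin (m + 1)) (Fin (m + 1)) K) := by
      ext j l
      simp [symbolVec, Matrix.one_apply, Pi.single_apply, eq_comm]
    rw [relCoeff, this, Matrix.det_one, mul_one, Fin.val_last]
  have hcast : ∀ l : Fin (m + 1), relCoeff (symbolVec K (m + 1) a) l.castSucc =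
      if (l : ℕ) < a then -(-1) ^ (m + 1) else (-1) ^ (m + 1) := fun l => by
    have h := symbolVec_sum K a (relCoeff (symbolVec K (m + 1) a)) l
    rw [sum_relCoeff_smul, hlast] at h
    split_ifs with hl <;> simp only [hl, if_true, if_false, Pi.zero_apply] at h <;>
      linear_combination -h
  rw [hrep]
  induction i using Fin.lastCases with
  | last =>
    have h1 : ¬ (m + 1 : ℕ) < a := by have := a.2; omega
    rw [hlast, Fin.val_last]
    rcases Nat.even_or_odd (m + 1) with h2 | h2 <;> simp [h2.neg_one_pow, h1]
  | cast l =>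
    rw [hcast, Fin.val_castSucc]
    rcases Nat.even_or_odd (m + 1) with h2 | h2 <;> by_cases hl : (l : ℕ) < a <;>
      simp [h2.neg_one_pow, hl]

lemma signCount_symbolSimplex (hn : 1 ≤ m + 1) (a : Fin ((m + 1) / 2 + 1)) :
    signCount (symbolSimplex K hn a) (-(-1) ^ (m + 1)) = a := by
  simp only [signCount, vertexSign_symbolSimplex]
  rw [Fin.card_filter_val_lt]
  have := a.2
  omega

lemma neg_neg_one_pow_eq_or (d : ℕ) : -(-1 : ℤ) ^ d = 1 ∨ -(-1 : ℤ) ^ d = -1 := by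
  rcases neg_one_pow_eq_or ℤ d with h | h <;> simp [h]

lemma signCount_neg_add (σ : OrdSimplex (genericComplex K (m + 1)) (m + 1)) :
    signCount σ (-(-1) ^ (m + 1)) + signCount σ ((-1) ^ (m + 1)) = m + 2 := by
  have h := signCount_add σ
  rcases neg_one_pow_eq_or ℤ (m + 1) with h1 | h1 <;> rw [h1]
  · rw [add_comm]; exact h
  · rw [neg_neg]; exact h

/-- The counts add up to n + 1, so the larger one exceeds ⌊n/2⌋ and equals no index `a`. -/
lemma typeIndicator_of_lt {σ : OrdSimplex (genericComplex K (m + 1)) (m + 1)}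
    (h : signCount σ (-(-1) ^ (m + 1)) < signCount σ ((-1) ^ (m + 1)))
    (a : Fin ((m + 1) / 2 + 1)) :
    typeIndicator σ a = if signCount σ (-(-1) ^ (m + 1)) = a then 1 else 0 := by
  have h1 := signCount_neg_add σ
  have h2 : ¬ signCount σ ((-1) ^ (m + 1)) = a := by have := a.2; omega
  rw [typeIndicator, if_neg h2, sub_zero]

lemma typeIndicator_of_gt {σ : OrdSimplex (genericComplex K (m + 1)) (m + 1)}
    (h : signCount σ ((-1) ^ (m + 1)) < signCount σ (-(-1) ^ (m + 1)))
    (a : Fin ((m + 1) / 2 + 1)) :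
    typeIndicator σ a = - if signCount σ ((-1) ^ (m + 1)) = a then 1 else 0 := by
  have h1 := signCount_neg_add σ
  have h2 : ¬ signCount σ (-(-1) ^ (m + 1)) = a := by have := a.2; omega
  rw [typeIndicator, if_neg h2, zero_sub]

lemma typeIndicator_of_eq {σ : OrdSimplex (genericComplex K (m + 1)) (m + 1)}
    (h : signCount σ (-(-1) ^ (m + 1)) = signCount σ ((-1) ^ (m + 1))) (a : ℕ) :
    typeIndicator σ a = 0 := by
  rw [typeIndicator, h, sub_self]

lemma typeIndicator_symbolSimplex (hn : 1 ≤ m + 1) (a b : Fin ((m + 1) / 2 + 1)) :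
    typeIndicator (symbolSimplex K hn a) b = if a = b then 1 else 0 := by
  have h1 := signCount_symbolSimplex (K := K) hn a
  have h2 := signCount_neg_add (symbolSimplex K hn a)
  have := a.2
  rw [typeIndicator_of_lt (by omega), h1]
  simp [Fin.ext_iff]

lemma plusValue_eq_sum_of_ne (hn : 1 ≤ m + 1)
    {σ : OrdSimplex (genericComplex K (m + 1)) (m + 1)}
    (h : signCount σ (-(-1) ^ (m + 1)) ≠ signCount σ ((-1) ^ (m + 1))) :
    plusValue σ = ∑ a : Fin ((m + 1) / 2 + 1), typeIndicator σ a • aPlus K hn a := by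
  have h1 := signCount_neg_add σ
  have hs := neg_neg_one_pow_eq_or (m + 1)
  rcases lt_or_gt_of_ne h with h2 | h2
  · simp only [typeIndicator_of_lt h2]
    rw [Finset.sum_eq_single (⟨signCount σ (-(-1) ^ (m + 1)), by omega⟩ : Fin ((m + 1) / 2 + 1))]
    · rw [if_pos rfl, one_smul]
      refine plusValue_eq hs ?_
      rw [signCount_symbolSimplex]
    · intro b _ hb
      rw [if_neg fun h => hb (Fin.ext h.symm), zero_smul]
    · simp
  · simp only [typeIndicator_of_gt h2]
    rw [Finset.sum_eq_single (⟨signCount σ ((-1) ^ (m + 1)), by omega⟩ : Fin ((m + 1) / 2 + 1))]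
    · rw [if_pos rfl, neg_smul, one_smul]
      refine plusValue_eq_neg (s := (-1) ^ (m + 1)) (neg_one_pow_eq_or ℤ (m + 1)) ?_
      rw [signCount_symbolSimplex]
    · intro b _ hb
      rw [if_neg fun h => hb (Fin.ext h.symm), neg_zero, zero_smul]
    · simp

/-- Balanced simplices vanish in `U₊`. -/
lemma plusValue_eq_zero_of_balanced (hn : 1 ≤ m + 1)
    {σ : OrdSimplex (genericComplex K (m + 1)) (m + 1)}
    (h : signCount σ (-(-1) ^ (m + 1)) = signCount σ ((-1) ^ (m + 1))) : plusValue σ = 0 := by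
  have hs := neg_neg_one_pow_eq_or (m + 1)
  have hcard := signCount_neg_add σ
  have h2 : plusValue σ = - plusValue σ :=
    plusValue_eq_neg hs (h.trans (by rw [neg_neg]))
  rcases Nat.lt_or_ge m 1 with hm | hm
  · obtain rfl : m = 0 := by omega
    exfalso
    obtain ⟨i, j, hij, he⟩ := exists_vertexSign_eq σ
    have key : ∀ s, vertexSign σ i = s → 2 ≤ signCount σ s := fun s hi => by
      refine (Finset.card_pair hij).symm.le.trans (Finset.card_le_card fun l hl => ?_)
      rcases Finset.mem_insert.1 hl with rfl | hl
      · simp [hi]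
      · rw [Finset.mem_singleton.1 hl]
        simp [← he, hi]
    rcases vertexSign_eq_one_or σ i with h1 | h1 <;> have := key _ h1 <;> simp at h hcard <;> omega
  -- Any (n + 1)-simplex serves: its unbalanced faces cancel in the boundary relation, and its
  -- balanced faces all have the value of `σ`, whose sign is immaterial because it is its own
  -- negative.
  obtain ⟨ρ⟩ := exists_ordSimplex_succ (by omega) σ
  have hbal : ∀ j : Fin (m + 3), plusValue (ρ.face j) =
      ∑ a : Fin ((m + 1) / 2 + 1), typeIndicator (ρ.face j) a • aPlus K hn a +
        if negCount (galeArea ρ.vec) j = posCount (galeArea ρ.vec) j then plusValue σ else 0 :=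
    fun j => by
      have hc := counts_galeArea ρ j
      have hiff : negCount (galeArea ρ.vec) j = posCount (galeArea ρ.vec) j ↔
          signCount (ρ.face j) (-(-1) ^ (m + 1)) = signCount (ρ.face j) ((-1) ^ (m + 1)) := by
        rw [hc.1, hc.2]
        rcases neg_one_pow_eq_or ℤ (m + 1) with h1 | h1 <;>
          rcases neg_one_pow_eq_or ℤ (j : ℕ) with h2 | h2 <;> rw [h1, h2] <;>
          simp [eq_comm]
      split_ifs with hj
      · rw [hiff] at hj
        have hcard' := signCount_neg_add (ρ.face j)
        simp only [typeIndicator_of_eq hj, zero_smul, Finset.sum_const_zero, zero_add]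
        exact plusValue_eq hs (by omega)
      · rw [hiff] at hj
        rw [add_zero]
        exact plusValue_eq_sum_of_ne hn hj
  have hsum := sum_tautValue_face (R := ZZ.{u}) (G := PGLPos K (m + 1)) ρ
  have hsign : ∀ (j : ℕ), (-1 : ℤ) ^ j • plusValue σ = plusValue σ := fun j => by
    rcases neg_one_pow_eq_or ℤ j with h1 | h1 <;> rw [h1]
    · rw [one_smul]
    · rw [neg_smul, one_smul, ← h2]
  have hzero : ∑ j : Fin (m + 3), (-1 : ℤ) ^ (j : ℕ) •
      ∑ a : Fin ((m + 1) / 2 + 1), typeIndicator (ρ.face j) a • aPlus K hn a = 0 := by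
    simp only [Finset.smul_sum, smul_smul]
    rw [Finset.sum_comm]
    refine Finset.sum_eq_zero fun a _ => ?_
    rw [← Finset.sum_smul, sum_typeIndicator_face, zero_smul]
  change ∑ j : Fin (m + 3), (-1 : ℤ) ^ (j : ℕ) • plusValue (ρ.face j) = 0 at hsum
  simp only [hbal, smul_add, Finset.sum_add_distrib, smul_ite, smul_zero, hsign] at hsum
  rw [hzero, zero_add, ← Finset.sum_filter, Finset.sum_const] at hsum
  -- Balance makes m + 2 even, so the number m + 3 of faces is odd. An odd multiple of an element
  -- killed by 2 is the element itself.
  obtain ⟨M, hM⟩ := (isPlanar_galeArea_vec ρ).odd_card_balanced (by omega) ⟨(m + 2) / 2, by omega⟩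
  have h2' : (2 : ℕ) • plusValue σ = 0 := by
    rw [two_smul]
    nth_rewrite 1 [h2]
    exact neg_add_cancel _
  rw [hM, add_smul, one_smul, mul_comm, mul_smul, h2', smul_zero, zero_add] at hsum
  exact hsum

lemma plusValue_eq_sum (hn : 1 ≤ m + 1) (σ : OrdSimplex (genericComplex K (m + 1)) (m + 1)) :
    plusValue σ = ∑ a : Fin ((m + 1) / 2 + 1), typeIndicator σ a • aPlus K hn a := by
  by_cases h : signCount σ (-(-1) ^ (m + 1)) = signCount σ ((-1) ^ (m + 1))
  · rw [plusValue_eq_zero_of_balanced hn h]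
    simp [typeIndicator_of_eq h]
  · exact plusValue_eq_sum_of_ne hn h

/-- `U₊` is free on the elements `a⁺`, and the coordinates of the value of a simplex are its
type indicators. -/
lemma exists_basis (hn : 1 ≤ m + 1) :
    ∃ b : Module.Basis (Fin ((m + 1) / 2 + 1)) ZZ.{u} (UPlus K (m + 1)),
      (∀ a, b a = aPlus K hn a) ∧
        ∀ σ a, b.coord a (plusValue σ) = ULift.up (typeIndicator σ a) := by
  -- The type indicators give a map from U₊ to the free module on the indices. It is inverse to the
  -- map sending basis vectors to the a⁺.
  obtain ⟨F, hF⟩ := exists_coeffGroup_lift (R := ZZ.{u}) (G := PGLPos K (m + 1))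
    (X := genericComplex K (m + 1)) (k := m + 1)
    (fun σ (a : Fin ((m + 1) / 2 + 1)) => (ULift.up (typeIndicator σ a) : ZZ.{u}))
    (fun σ t => by
      ext a
      simp [typeIndicator_perm])
    (fun g σ => by simp only [typeIndicator_act])
    (fun ρ => by
      ext a
      have h := sum_typeIndicator_face ρ a
      rw [Finset.sum_apply]
      exact (map_sum (AddEquiv.ulift : ZZ.{u} ≃+ ℤ) _ _).trans h)
  have hFa : ∀ a, F (aPlus K hn a) = Pi.single a 1 := fun a => by
    refine (hF (symbolSimplex K hn a)).trans ?_
    ext b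
    simp only [typeIndicator_symbolSimplex, Pi.single_apply, eq_comm]
    split_ifs <;> rfl
  let F' : (Fin ((m + 1) / 2 + 1) → ZZ.{u}) →ₗ[ZZ.{u}] UPlus K (m + 1) :=
    Fintype.linearCombination ZZ.{u} (aPlus K hn)
  have hF'F : F' ∘ₗ F = LinearMap.id := coeffGroup_hom_ext fun σ => by
    change F' (F (tautValue _ _ σ)) = tautValue _ _ σ
    rw [hF]
    exact (plusValue_eq_sum hn σ).symm
  have hF'a : ∀ a, F' (Pi.single a 1) = aPlus K hn a := fun a => by
    simp [F', Fintype.linearCombination_apply_single]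
  have hFF' : F ∘ₗ F' = LinearMap.id := by
    refine LinearMap.pi_ext' fun a => LinearMap.ext_ring ?_
    change F (F' (Pi.single a 1)) = Pi.single a 1
    rw [hF'a, hFa]
  refine ⟨Module.Basis.ofEquivFun (LinearEquiv.ofLinearMap F F' hFF' hF'F), fun a => ?_,
    fun σ a => ?_⟩
  · rw [Module.Basis.coe_ofEquivFun]
    exact hF'a a
  · rw [Module.Basis.coord_apply, Module.Basis.ofEquivFun_repr_apply]
    exact congrFun (hF σ) a

end Signs

/-! ### Evaluation of equivariant cochains on simplices -/

section Hom

variable {R G V : Type u} [CommRing R] [Group G] {X : AbstractSimplicialComplex V}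
  [MulAction G V] [SimplicialAction G X] {k : ℕ}

/-- A map of chains to a `G`-module is determined by its values on simplices. -/
lemma chainComplex_hom_ext {A : Rep.{u} R G} {f g : (chainComplex R X G).X k ⟶ A}
    (h : ∀ σ, f.hom (simplexChain R G σ) = g.hom (simplexChain R G σ)) : f = g :=
  Rep.hom_ext (Representation.IntertwiningMap.ext (Chain.hom_ext (X := X) h))

lemma hom_sum_zsmul_apply {A B : Rep.{u} R G} {ι : Type*} (s : Finset ι) (a : ι → ℤ)
    (f : ι → (A ⟶ B)) (x : A) :
    (∑ i ∈ s, a i • f i).hom x = ∑ i ∈ s, a i • (f i).hom x := by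
  let F : (A ⟶ B) →+ B := { toFun := fun f => f.hom x, map_zero' := rfl, map_add' := fun _ _ => rfl }
  refine (map_sum F _ _).trans (Finset.sum_congr rfl fun i _ => ?_)
  exact map_zsmul F _ _

lemma d_comp_hom_simplexChain {A : Rep.{u} R G} (c : (chainComplex R X G).X k ⟶ A)
    (σ : OrdSimplex X (k + 1)) :
    ((chainComplex R X G).d (k + 1) k ≫ c).hom (simplexChain R G σ) =
      ∑ i : Fin (k + 2), (-1 : ℤ) ^ (i : ℕ) • c.hom (simplexChain R G (σ.face i)) := by
  rw [chainComplex_d]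
  change c.hom (boundary R X k (Chain.of R σ)) = _
  rw [boundary_of]
  refine (map_sum c.hom _ _).trans (Finset.sum_congr rfl fun i _ => ?_)
  exact map_zsmul c.hom _ _

end Hom

/-! ### The determinant cochain and its coboundary -/

section DetCochain

variable (K : Type u) [Field K] [LinearOrder K] [IsStrictOrderedRing K] (m : ℕ)

/-- The function `c([v₁], …, [v_n]) = (-1)ⁿ sgn det(v₁, …, v_n)` on ordered simplices, for
`n = m + 1`. -/
def detValue (σ : OrdSimplex (genericComplex K (m + 1)) m) : ZZ.{u} :=
  ULift.up ((-1) ^ (m + 1) * orient σ.1)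

lemma detValue_perm (σ : OrdSimplex (genericComplex K (m + 1)) m)
    (t : Equiv.Perm (Fin (m + 1))) :
    detValue K m (σ.perm t) = (Equiv.Perm.sign t : ℤ) • detValue K m σ := by
  have h : orient (σ.perm t).1 = Equiv.Perm.sign t * orient σ.1 := orient_comp_perm σ.1 t
  ext
  rw [detValue, h]
  change (-1) ^ (m + 1) * _ = ((Equiv.Perm.sign t : ℤˣ) : ℤ) * ((-1) ^ (m + 1) * orient σ.1)
  ring

/-- The cochain `c([v₁], …, [v_n]) = (-1)ⁿ sgn det(v₁, …, v_n)`, for `n = m + 1`. -/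
def detCochain : (chainsPlus K (m + 1)).X m ⟶ Rep.trivial ZZ.{u} (PGLPos K (m + 1)) ZZ.{u} :=
  Rep.ofHom (ρ := chainRep ZZ.{u} (genericComplex K (m + 1)) m (PGLPos K (m + 1)))
    ⟨Chain.lift (detValue K m) (detValue_perm K m), fun g => by
      refine Chain.hom_ext fun σ => ?_
      have h : orient (σ.act g).1 = orient σ.1 := orient_smul g σ.1
      change Chain.lift (detValue K m) (detValue_perm K m)
        (chainRep ZZ.{u} _ m (PGLPos K (m + 1)) g (Chain.of _ σ)) =
        Chain.lift (detValue K m) (detValue_perm K m) (Chain.of _ σ)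
      rw [chainRep_of, Chain.lift_of, Chain.lift_of, detValue, detValue, h]⟩

variable {K m}

lemma detCochain_simplexChain (σ : OrdSimplex (genericComplex K (m + 1)) m) :
    (detCochain K m).hom (simplexChain ZZ.{u} (PGLPos K (m + 1)) σ) =
      ULift.up ((-1) ^ (m + 1) * orient σ.1) :=
  Chain.lift_of (detValue K m) (detValue_perm K m) σ

/-- The boundary sign times the orientation of the i-th face is the i-th vertex sign, by definition.
-/
lemma detCochain_boundary (σ : OrdSimplex (genericComplex K (m + 1)) (m + 1)) :
    ((chainsPlus K (m + 1)).d (m + 1) m ≫ detCochain K m).hom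
        (simplexChain ZZ.{u} (PGLPos K (m + 1)) σ) =
      ULift.up ((-1) ^ (m + 1) * ∑ i, vertexSign σ i) := by
  refine (d_comp_hom_simplexChain (detCochain K m) σ).trans ?_
  rw [Finset.mul_sum]
  refine Eq.trans ?_ (map_sum (AddEquiv.ulift : ZZ.{u} ≃+ ℤ).symm _ _).symm
  refine Finset.sum_congr rfl fun i _ => ?_
  rw [detCochain_simplexChain]
  ext
  change (-1) ^ (i : ℕ) * _ = (-1) ^ (m + 1) * vertexSign σ i
  rw [vertexSign]
  ring

/-- Both sides are the number of vertices of sign (-1)ⁿ minus the number of sign -(-1)ⁿ. If the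
smaller count is `a`, the difference is ±(n + 1 - 2a), and the type indicator supplies the sign. -/
lemma sum_mul_typeIndicator (σ : OrdSimplex (genericComplex K (m + 1)) (m + 1)) :
    ∑ a : Fin ((m + 1) / 2 + 1), ((m + 1 : ℕ) - 2 * (a : ℤ) + 1) * typeIndicator σ a =
      (-1) ^ (m + 1) * ∑ i, vertexSign σ i := by
  have h1 := signCount_neg_add σ
  have h2 : (-1) ^ (m + 1) * ∑ i, vertexSign σ i =
      (signCount σ ((-1) ^ (m + 1)) : ℤ) - signCount σ (-(-1) ^ (m + 1)) := by
    rw [sum_vertexSign]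
    rcases neg_one_pow_eq_or ℤ (m + 1) with h | h <;> rw [h]
    · ring
    · rw [neg_neg]; ring
  rw [h2]
  rcases lt_trichotomy (signCount σ (-(-1) ^ (m + 1))) (signCount σ ((-1) ^ (m + 1)))
    with h | h | h
  · simp only [typeIndicator_of_lt h]
    rw [Finset.sum_eq_single (⟨signCount σ (-(-1) ^ (m + 1)), by omega⟩ : Fin ((m + 1) / 2 + 1))]
    · rw [if_pos rfl]
      push_cast
      omega
    · intro b _ hb
      rw [if_neg fun h => hb (Fin.ext h.symm), mul_zero]
    · simp
  · simp [typeIndicator_of_eq h, h]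
  · simp only [typeIndicator_of_gt h]
    rw [Finset.sum_eq_single (⟨signCount σ ((-1) ^ (m + 1)), by omega⟩ : Fin ((m + 1) / 2 + 1))]
    · rw [if_pos rfl]
      push_cast
      omega
    · intro b _ hb
      rw [if_neg fun h => hb (Fin.ext h.symm), neg_zero, mul_zero]
    · simp

lemma detCochain_relation
    (b : Module.Basis (Fin ((m + 1) / 2 + 1)) ZZ.{u} (UPlus K (m + 1)))
    (hb : ∀ σ a, b.coord a (plusValue σ) = ULift.up (typeIndicator σ a)) :
    (chainsPlus K (m + 1)).d (m + 1) m ≫ detCochain K m =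
      ∑ a : Fin ((m + 1) / 2 + 1),
        (((m + 1 : ℕ) : ℤ) - 2 * (a : ℤ) + 1) • cocycleComponent (b.coord a) := by
  refine chainComplex_hom_ext fun σ => ?_
  refine (detCochain_boundary σ).trans (Eq.trans ?_ (hom_sum_zsmul_apply _ _ _ _).symm)
  rw [← sum_mul_typeIndicator]
  refine (map_sum (AddEquiv.ulift : ZZ.{u} ≃+ ℤ).symm _ _).trans ?_
  refine Finset.sum_congr rfl fun a _ => ?_
  change _ = _ • b.coord a (plusValue σ)
  rw [hb]
  rfl

end DetCochain

end Taut

end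

theorem theorem9p1 {K : Type u} [Field K] [LinearOrder K] [IsStrictOrderedRing K]
    (n : ℕ) (hn : 1 ≤ n) :
    -- `U₊` is free on the elements `k⁺`, `0 ≤ k ≤ ⌊n/2⌋`; `b.coord k` is the projection to `ℤ k⁺`
    ∃ b : Module.Basis (Fin (n / 2 + 1)) Taut.ZZ.{u} (Taut.UPlus K n),
      (∀ k, b k = Taut.aPlus K hn k) ∧
      -- the relation between cocycles, with the explicit cochain `c`
      (∃ c : (Taut.chainsPlus K n).X (n - 1) ⟶
          Rep.trivial Taut.ZZ.{u} (Taut.PGLPos K n) Taut.ZZ.{u},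
        (∀ (σ : Taut.OrdSimplex (Taut.genericComplex K n) (n - 1))
          (v : Fin (n - 1 + 1) → Fin n → K) (hv : ∀ i, v i ≠ 0),
          (∀ i, σ.1 i = rayOfNeZero K (v i) (hv i)) →
            c.hom (Taut.simplexChain Taut.ZZ.{u} (Taut.PGLPos K n) σ) =
              ULift.up ((-1) ^ n * Taut.detSign hn v)) ∧
        (Taut.chainsPlus K n).d n (n - 1) ≫ c =
          ∑ k : Fin (n / 2 + 1),
            ((n : ℤ) - 2 * (k : ℤ) + 1) • Taut.cocycleComponent (b.coord k)) ∧
      -- the relation between classes; `eu₊` is computed with any map of resolutions `ψ`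
      (∃ ψ : Rep.barComplex Taut.ZZ.{u} (Taut.PGLPos K n) ⟶ Taut.chainsPlus K n,
        Taut.IsResolutionMap ψ) ∧
      ∀ ψ : Rep.barComplex Taut.ZZ.{u} (Taut.PGLPos K n) ⟶ Taut.chainsPlus K n,
        Taut.IsResolutionMap ψ →
          ∑ k : Fin (n / 2 + 1),
            ((n : ℤ) - 2 * (k : ℤ) + 1) • Taut.eulerComponent ψ (b.coord k) = 0 := by
  obtain ⟨m, rfl⟩ : ∃ m, n = m + 1 := ⟨n - 1, by omega⟩
  obtain ⟨b, hb, hcoord⟩ := Taut.exists_basis (K := K) hn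
  refine ⟨b, hb, ⟨Taut.detCochain K m, fun σ v hv hσ => ?_, Taut.detCochain_relation b hcoord⟩,
    Taut.exists_resolutionMap (Taut.hasConePoints_genericComplex hn), fun ψ _ => ?_⟩
  · refine (Taut.detCochain_simplexChain σ).trans ?_
    have h : Taut.orient σ.1 = Taut.detSign hn v := Taut.orient_eq_of_rep σ.1 v hv hσ
    rw [h]
  · exact Taut.sum_coeffMap_tautClass_eq_zero ψ m _ (fun k => b.coord k) (Taut.detCochain K m)
      (Taut.detCochain_relation b hcoord)
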